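/- Let $\Bbbk$ be an algebraically closed field. A $\Bbbk$-linear category is *finitary* if it is additive, has split idempotents, finite dimensional morphism spaces and only finitely many isomorphism classes of indecomposable objects. A strict $2$-category $\mathscr{C}$ is *finitary* if it has finitely many objects, all categories $\mathscr{C}(\mathtt{i},\mathtt{j})$ are finitary $\Bbbk$-linear, horizontal composition is biadditive and $\Bbbk$-bilinear, and all identity $1$-morphisms are indecomposable. A *finitary $2$-representation* $\mathbf{M}$ of $\mathscr{C}$ is a strict $2$-functor from $\mathscr{C}$ to the $2$-category of finitary $\Bbbk$-linear categories, additive $\Bbbk$-linear functors and natural transformations. Two $2$-representations are *equivalent* if there is a $2$-natural transformation between them (additive $\Bbbk$-linear functors $\Phi_{\mathtt{i}}$ together with natural isomorphisms $\Phi_{\mathtt{j}}\circ\mathbf{M}(\mathrm{F})\cong\mathbf{N}(\mathrm{F})\circ\Phi_{\mathtt{i}}$, natural in the $1$-morphism $\mathrm{F}$ and compatible with identities and composition of $1$-morphisms) all of whose components $\Phi_{\mathtt{i}}$ are equivalences of categories. An *ideal* of $\mathbf{M}$ consists of an ideal in each $\mathbf{M}(\mathtt{i})$, stable under the action of $\mathscr{C}$.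 $\mathbf{M}$ is *transitive* if for every $\mathtt{i}$ and every non-zero $X\in\mathbf{M}(\mathtt{i})$, the additive closure of all $\mathbf{M}(\mathrm{F})X$, for $\mathrm{F}$ a $1$-morphism with domain $\mathtt{i}$, is all of $\mathbf{M}$. The *simple transitive quotient* $\underline{\mathbf{M}}$ of a transitive $\mathbf{M}$ is the quotient of $\mathbf{M}$ by its largest ideal containing no identity morphism of a non-zero object. If $\mathbf{X}$ is a set of isomorphism classes of indecomposable objects of $\coprod_{\mathtt{i}}\mathbf{M}(\mathtt{i})$ which contains every indecomposable direct summand of $\mathbf{M}(\mathrm{F})X$ for all $X\in\mathbf{X}$ and all $1$-morphisms $\mathrm{F}$, let $\mathbf{M}_{\mathbf{X}}$ be the restriction of $\mathbf{M}$ to the additive closure of $\mathbf{X}$. For two such sets $\mathbf{X}\subsetneq\mathbf{Y}$ let $\mathbf{M}_{\mathbf{Y}}/\mathbf{M}_{\mathbf{X}}$ be the quotient of $\mathbf{M}_{\mathbf{Y}}$ by the ideal generated by the identity morphisms of the objects of $\mathbf{M}_{\mathbf{X}}$; whenever it is transitive, its simple transitive quotient is called a *simple transitive subquotient* of $\mathbf{M}$.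 A finitary $2$-representation is *isotypic* if all its simple transitive subquotients are equivalent. For a finitary $\Bbbk$-linear category $\mathcal{A}$, the *$\mathcal{A}$-inflation* $\mathbf{M}^{\boxtimes\mathcal{A}}$ of $\mathbf{M}$ sends $\mathtt{i}$ to $\mathbf{M}(\mathtt{i})\boxtimes\mathcal{A}$, a $1$-morphism $\mathrm{F}$ to $\mathbf{M}(\mathrm{F})\boxtimes\mathrm{Id}_{\mathcal{A}}$ and a $2$-morphism $\alpha$ to $\mathbf{M}(\alpha)\boxtimes\mathrm{id}$. Here $\mathcal{B}\boxtimes\mathcal{A}$ is the category of finite formal direct sums $\bigoplus_i X_i\boxtimes Y_i$ with $X_i\in\mathcal{B}$, $Y_i\in\mathcal{A}$, whose morphisms are matrices with entries in $\mathrm{Hom}_{\mathcal{B}}(X_i,U_j)\otimes_{\Bbbk}\mathrm{Hom}_{\mathcal{A}}(Y_i,V_j)$. **Proposition.** Let $\mathscr{C}$ be a finitary $2$-category over $\Bbbk$, let $\mathbf{M}$ be a transitive finitary $2$-representation of $\mathscr{C}$ and let $\mathcal{A}$ be a finitary $\Bbbk$-linear category. Then $\mathbf{M}^{\boxtimes\mathcal{A}}$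 is a finitary $2$-representation of $\mathscr{C}$ and it is isotypic. Moreover, every simple transitive subquotient of $\mathbf{M}^{\boxtimes\mathcal{A}}$ is equivalent to the simple transitive quotient $\underline{\mathbf{M}}$ of $\mathbf{M}$. -/

import Mathlib

open CategoryTheory CategoryTheory.Limits
open scoped Bicategory TensorProduct

universe w u₁ v₁ w₁ u v u' v' u'' v''

noncomputable section

namespace TwoRepTheory

/-! ### Finitary linear categories -/

section Categories

variable (k : Type w) [Field k]

/-- An indecomposable object: it is nonzero and, in every decomposition as a direct sum of two
objects, one of the summands is zero. -/
def IsIndec {D : Type u} [Category.{v} D] [Preadditive D] [HasFiniteBiproducts D] (X : D) : Prop :=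
  haveI : HasBinaryBiproducts D := hasBinaryBiproducts_of_finite_biproducts D
  Indecomposable X

/-- The additive closure `add P` of a class `P` of objects: all direct summands of finite
direct sums of objects in `P`. -/
def addClosure {D : Type u} [Category.{v} D] [Preadditive D] [HasFiniteBiproducts D]
    (P : ObjectProperty D) : ObjectProperty D := fun Z =>
  ∃ (n : ℕ) (f : Fin n → D), (∀ a, P (f a)) ∧ Nonempty (Retract Z (⨁ f))

/-- An additive `k`-linear category is finitary if it has split idempotents, finite dimensional
morphism spaces and finitely many isomorphism classes of indecomposable objects. -/
class IsFinitaryCategory (D : Type u) [Category.{v} D] [Preadditive D] [Linear k D] : Prop where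
  hasFiniteBiproducts : HasFiniteBiproducts D
  isIdempotentComplete : IsIdempotentComplete D
  finiteDimensional : ∀ X Y : D, Module.Finite k (X ⟶ Y)
  finite_indec : ∃ S : Set D, S.Finite ∧ ∀ X : D, IsIndec X → ∃ Y ∈ S, Nonempty (X ≅ Y)

/-- A finitary `2`-category over `k`: a (strict) `2`-category with finitely many objects, whose
categories of `1`-morphisms are finitary, with additive and `k`-linear horizontal composition
and indecomposable identity `1`-morphisms. -/
class IsFinitaryTwoCategory (C : Type u₁) [Bicategory.{w₁, v₁} C] [Bicategory.Strict C]
    [∀ i j : C, Preadditive (i ⟶ j)] [∀ i j : C, Linear k (i ⟶ j)] : Prop where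
  finite_objects : Finite C
  finitary_hom : ∀ i j : C, IsFinitaryCategory k (i ⟶ j)
  whiskerLeft_add : ∀ {i j l : C} (F : i ⟶ j) {G H : j ⟶ l} (α β : G ⟶ H),
    F ◁ (α + β) = F ◁ α + F ◁ β
  whiskerLeft_smul : ∀ {i j l : C} (F : i ⟶ j) {G H : j ⟶ l} (c : k) (α : G ⟶ H),
    F ◁ (c • α) = c • (F ◁ α)
  add_whiskerRight : ∀ {i j l : C} {F G : i ⟶ j} (α β : F ⟶ G) (H : j ⟶ l),
    (α + β) ▷ H = α ▷ H + β ▷ H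
  smul_whiskerRight : ∀ {i j l : C} {F G : i ⟶ j} (c : k) (α : F ⟶ G) (H : j ⟶ l),
    (c • α) ▷ H = c • (α ▷ H)
  indec_id : ∀ i : C,
    haveI := (finitary_hom i i).hasFiniteBiproducts
    IsIndec (𝟙 i)

end Categories

lemma finrank_end_lt {D : Type u} [Category.{v} D] [Preadditive D] (k : Type w) [Field k] [Linear k D]
    (hk : ∀ X Y : D, Module.Finite k (X ⟶ Y)) {X Y : D} (r : Retract Y X)
    (h : ∀ f : Y ⟶ Y, r.r ≫ f ≫ r.i ≠ 𝟙 X) :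
    Module.finrank k (Y ⟶ Y) < Module.finrank k (X ⟶ X) := by
  let φ : (Y ⟶ Y) →ₗ[k] (X ⟶ X) :=
    { toFun := fun f => r.r ≫ f ≫ r.i
      map_add' := by intros; simp
      map_smul' := by intros; simp }
  have hφ : Function.Injective φ := by
    intro f g hfg
    have : r.i ≫ (r.r ≫ f ≫ r.i) ≫ r.r = r.i ≫ (r.r ≫ g ≫ r.i) ≫ r.r :=
      congrArg (fun t => r.i ≫ t ≫ r.r) hfg
    simpa using this
  rw [← LinearMap.finrank_range_of_inj hφ]
  have := hk X X
  refine Submodule.finrank_lt (fun ht => ?_)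
  have : 𝟙 X ∈ LinearMap.range φ := ht ▸ Submodule.mem_top
  obtain ⟨f, hf⟩ := this
  exact h f hf

section AddClosure

variable {D : Type u} [Category.{v} D] [Preadditive D] [HasFiniteBiproducts D]
  {P Q : ObjectProperty D}

lemma addClosure_of_retract {X Y : D} (r : Retract X Y) (h : addClosure P Y) :
    addClosure P X := by
  obtain ⟨n, f, hf, ⟨s⟩⟩ := h
  exact ⟨n, f, hf, ⟨r.trans s⟩⟩

lemma addClosure_biproduct_of_mem {ι : Type} [Finite ι] (f : ι → D) (hf : ∀ a, P (f a)) :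
    addClosure P (⨁ f) := by
  obtain ⟨n, ⟨e⟩⟩ := Finite.exists_equiv_fin ι
  refine ⟨n, f ∘ e.symm, fun a => hf _, ⟨Retract.ofIso ?_⟩⟩
  exact biproduct.whiskerEquiv e (fun j => eqToIso (by simp))

lemma le_addClosure {X : D} (h : P X) : addClosure P X :=
  addClosure_of_retract (Y := ⨁ fun _ : Unit => X)
    ⟨biproduct.ι (fun _ : Unit => X) (), biproduct.π (fun _ : Unit => X) (), by simp⟩
    (addClosure_biproduct_of_mem _ fun _ => h)

lemma addClosure_biproduct {ι : Type} [Finite ι] (f : ι → D) (hf : ∀ a, addClosure P (f a)) :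
    addClosure P (⨁ f) := by
  choose n g hg r using hf
  have s : ∀ a, Retract (f a) (⨁ g a) := fun a => (r a).some
  refine addClosure_of_retract (Y := ⨁ fun a => ⨁ g a)
    ⟨biproduct.map fun a => (s a).i, biproduct.map fun a => (s a).r, ?_⟩ ?_
  · ext a b
    simp
  · refine addClosure_of_retract (Retract.ofIso (biproductBiproductIso _ g)) ?_
    exact addClosure_biproduct_of_mem _ fun p => hg p.1 p.2

lemma addClosure_map {E : Type u} [Category.{v} E] [Preadditive E] [HasFiniteBiproducts E]
    (F : D ⥤ E) [F.Additive] {Q : ObjectProperty E}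
    (h : ∀ X, P X → addClosure Q (F.obj X)) {X : D} (hX : addClosure P X) :
    addClosure Q (F.obj X) := by
  obtain ⟨n, f, hf, ⟨r⟩⟩ := hX
  refine addClosure_of_retract ((r.map F).trans (Retract.ofIso (F.mapBiproduct f))) ?_
  exact addClosure_biproduct _ fun a => h _ (hf a)

instance hasFiniteBiproducts_addClosure : HasFiniteBiproducts (addClosure P).FullSubcategory where
  out n :=
    { has_biproduct := fun f => HasBiproduct.mk
        { bicone :=
            { pt := ⟨⨁ fun a => (f a).obj, addClosure_biproduct _ fun a => (f a).property⟩
              π := fun a => ObjectProperty.homMk (biproduct.π (fun a => (f a).obj) a)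
              ι := fun a => ObjectProperty.homMk (biproduct.ι (fun a => (f a).obj) a)
              ι_π := fun a b => by
                ext
                by_cases h : a = b
                · subst h; simp
                · simp [h] }
          isBilimit := isBilimitOfTotal _ (by
            ext
            have h : ∀ {J : Type} (s : Finset J) {X Y : (addClosure P).FullSubcategory}
                (g : J → (X ⟶ Y)), (∑ j ∈ s, g j).hom = ∑ j ∈ s, (g j).hom :=
              fun s _ _ g => (addClosure P).ι.map_sum g s
            rw [h]
            exact congrArg (fun t => _ ≫ t ≫ _) (biproduct.total (f := fun a => (f a).obj))) } }

lemma addClosure_mono (h : ∀ X, P X → Q X) {X : D} (hX : addClosure P X) : addClosure Q X := by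
  obtain ⟨n, f, hf, r⟩ := hX
  exact ⟨n, f, fun a => h _ (hf a), r⟩

/-- In an additive category with finite dimensional morphism spaces every object is a finite
direct sum of indecomposable objects. -/
lemma addClosure_isIndec (k : Type w) [Field k] [Linear k D]
    (hk : ∀ X Y : D, Module.Finite k (X ⟶ Y)) (X : D) :
    addClosure (fun Z => IsIndec Z ∧ Nonempty (Retract Z X)) X := by
  have : HasBinaryBiproducts D := hasBinaryBiproducts_of_finite_biproducts D
  induction hn : Module.finrank k (X ⟶ X) using Nat.strong_induction_on generalizing X with
  | _ n ih =>
    by_cases h0 : IsZero X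
    · exact ⟨0, Fin.elim0, fun a => a.elim0, ⟨⟨0, 0, h0.eq_of_src _ _⟩⟩⟩
    by_cases h1 : IsIndec X
    · exact le_addClosure ⟨h1, ⟨Retract.refl X⟩⟩
    have h2 : ∃ Y Z : D, ∃ _ : X ≅ Y ⊞ Z, ¬ IsZero Y ∧ ¬ IsZero Z := by
      by_contra hcon
      push Not at hcon
      refine h1 ⟨h0, fun Y Z e => ?_⟩
      by_cases hY : IsZero Y
      · exact Or.inl hY
      · exact Or.inr (hcon Y Z e hY)
    obtain ⟨Y, Z, e, hY, hZ⟩ := h2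
    let rY : Retract Y X := ⟨biprod.inl ≫ e.inv, e.hom ≫ biprod.fst, by simp⟩
    let rZ : Retract Z X := ⟨biprod.inr ≫ e.inv, e.hom ≫ biprod.snd, by simp⟩
    have hYlt := finrank_end_lt k hk rY (fun f hf => hZ ((IsZero.iff_id_eq_zero Z).2 (by
      have := congrArg (fun t => rZ.i ≫ t ≫ rZ.r) hf
      simpa [rY, rZ] using this.symm)))
    have hZlt := finrank_end_lt k hk rZ (fun f hf => hY ((IsZero.iff_id_eq_zero Y).2 (by
      have := congrArg (fun t => rY.i ≫ t ≫ rY.r) hf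
      simpa [rY, rZ] using this.symm)))
    have aY := addClosure_mono (Q := fun W => IsIndec W ∧ Nonempty (Retract W X))
      (fun W hW => ⟨hW.1, hW.2.map fun s => s.trans rY⟩) (ih _ (hn ▸ hYlt) Y rfl)
    have aZ := addClosure_mono (Q := fun W => IsIndec W ∧ Nonempty (Retract W X))
      (fun W hW => ⟨hW.1, hW.2.map fun s => s.trans rZ⟩) (ih _ (hn ▸ hZlt) Z rfl)
    let g : Bool → D := fun b => cond b Y Z
    refine addClosure_of_retract (Y := ⨁ g) ⟨rY.r ≫ biproduct.ι g true + rZ.r ≫ biproduct.ι g false,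
      biproduct.π g true ≫ rY.i + biproduct.π g false ≫ rZ.i, ?_⟩
      (addClosure_biproduct g fun b => by cases b <;> assumption)
    have h3 : rY.r ≫ rY.i + rZ.r ≫ rZ.i = 𝟙 X := by
      have h4 : (biprod.fst : Y ⊞ Z ⟶ Y) ≫ biprod.inl + biprod.snd ≫ biprod.inr = 𝟙 (Y ⊞ Z) :=
        biprod.total
      calc rY.r ≫ rY.i + rZ.r ≫ rZ.i
          = e.hom ≫ ((biprod.fst : Y ⊞ Z ⟶ Y) ≫ biprod.inl + biprod.snd ≫ biprod.inr) ≫ e.inv := by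
            simp only [rY, rZ, Preadditive.add_comp, Preadditive.comp_add, Category.assoc]
        _ = 𝟙 X := by rw [h4]; simp
    simp only [Preadditive.add_comp, Preadditive.comp_add, Category.assoc,
      biproduct.ι_π_self_assoc]
    rw [biproduct.ι_π_ne_assoc g (by decide : true ≠ false),
      biproduct.ι_π_ne_assoc g (by decide : false ≠ true)]
    simpa [g] using h3

end AddClosure

/-! ### Additive 2-representations -/

section TwoRep

variable (k : Type w) [Field k] (C : Type u₁) [Bicategory.{w₁, v₁} C]

/-- A strict `2`-functor from `C` to the `2`-category of additive `k`-linear categories, additive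
`k`-linear functors and natural transformations. (The compatibilities of a strict `2`-functor
with the unitors and associators are automatic, since these are identities. The
maps on `2`-morphism spaces are not required to be linear.) -/
structure TwoRep where
  /-- the category attached to an object -/
  obj : C → Type u
  [cat : ∀ i, Category.{v} (obj i)]
  [preadditive : ∀ i, Preadditive (obj i)]
  [linear : ∀ i, Linear k (obj i)]
  [hasFiniteBiproducts : ∀ i, HasFiniteBiproducts (obj i)]
  /-- the functor attached to a `1`-morphism -/
  map : ∀ {i j : C}, (i ⟶ j) → (obj i ⥤ obj j)
  [map_additive : ∀ {i j : C} (F : i ⟶ j), (map F).Additive]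
  [map_linear : ∀ {i j : C} (F : i ⟶ j), (map F).Linear k]
  /-- the natural transformation attached to a `2`-morphism -/
  map₂ : ∀ {i j : C} {F G : i ⟶ j}, (F ⟶ G) → (map F ⟶ map G)
  map_id : ∀ i : C, map (𝟙 i) = 𝟭 (obj i)
  map_comp : ∀ {i j l : C} (F : i ⟶ j) (G : j ⟶ l), map (F ≫ G) = map F ⋙ map G
  map₂_id : ∀ {i j : C} (F : i ⟶ j), map₂ (𝟙 F) = 𝟙 (map F)
  map₂_comp : ∀ {i j : C} {F G H : i ⟶ j} (α : F ⟶ G) (β : G ⟶ H),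
    map₂ (α ≫ β) = map₂ α ≫ map₂ β
  map₂_whiskerLeft : ∀ {i j l : C} (F : i ⟶ j) {G H : j ⟶ l} (β : G ⟶ H),
    map₂ (F ◁ β) = eqToHom (map_comp F G) ≫ Functor.whiskerLeft (map F) (map₂ β) ≫
      eqToHom (map_comp F H).symm
  map₂_whiskerRight : ∀ {i j l : C} {F G : i ⟶ j} (α : F ⟶ G) (H : j ⟶ l),
    map₂ (α ▷ H) = eqToHom (map_comp F H) ≫ Functor.whiskerRight (map₂ α) (map H) ≫
      eqToHom (map_comp G H).symm

attribute [instance] TwoRep.cat TwoRep.preadditive TwoRep.linear TwoRep.hasFiniteBiproducts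
  TwoRep.map_additive TwoRep.map_linear

end TwoRep

namespace TwoRep

variable {k : Type w} [Field k] {C : Type u₁} [Bicategory.{w₁, v₁} C]

/-- A finitary `2`-representation: all the categories `M(i)` are finitary. -/
class IsFinitary (M : TwoRep.{w, u₁, v₁, w₁, u, v} k C) : Prop where
  finitary : ∀ i : C, IsFinitaryCategory k (M.obj i)

/-! ### 2-natural transformations and equivalence -/

/-- A `2`-natural transformation between `2`-representations, in the usual non-strict sense:
additive `k`-linear functors `Φ_i : M(i) ⥤ N(i)` together with natural isomorphisms
`Φ_j ∘ M(F) ≅ N(F) ∘ Φ_i` that are natural in the `1`-morphism `F` and compatible with identities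
and with composition of `1`-morphisms. -/
structure TwoNatTrans (M : TwoRep.{w, u₁, v₁, w₁, u, v} k C) (N : TwoRep.{w, u₁, v₁, w₁, u', v'} k C) where
  /-- the component at an object -/
  app : ∀ i : C, M.obj i ⥤ N.obj i
  app_additive : ∀ i : C, (app i).Additive
  app_linear : ∀ i : C, haveI := app_additive i; (app i).Linear k
  /-- the structure isomorphism at a `1`-morphism -/
  iso : ∀ {i j : C} (F : i ⟶ j), M.map F ⋙ app j ≅ app i ⋙ N.map F
  naturality : ∀ {i j : C} {F G : i ⟶ j} (α : F ⟶ G),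
    (iso F).hom ≫ Functor.whiskerLeft (app i) (N.map₂ α) =
      Functor.whiskerRight (M.map₂ α) (app j) ≫ (iso G).hom
  iso_id : ∀ (i : C) (X : M.obj i),
    (iso (𝟙 i)).hom.app X =
      eqToHom (by simp only [Functor.comp_obj, M.map_id, N.map_id, Functor.id_obj])
  iso_comp : ∀ {i j l : C} (F : i ⟶ j) (G : j ⟶ l) (X : M.obj i),
    (iso (F ≫ G)).hom.app X =
      eqToHom (by simp only [Functor.comp_obj, M.map_comp]) ≫
        (iso G).hom.app ((M.map F).obj X) ≫ (N.map G).map ((iso F).hom.app X) ≫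
          eqToHom (by simp only [Functor.comp_obj, N.map_comp])

/-- Two `2`-representations are equivalent if there is a `2`-natural transformation all of whose
components are equivalences of categories. -/
def Equivalent (M : TwoRep.{w, u₁, v₁, w₁, u, v} k C) (N : TwoRep.{w, u₁, v₁, w₁, u', v'} k C) :
    Prop :=
  ∃ Φ : TwoNatTrans M N, ∀ i : C, (Φ.app i).IsEquivalence

/-! ### Stable sets of indecomposable objects and 2-subrepresentations -/

/-- A set of isomorphism classes of indecomposable objects of `∐ i, M(i)` that is stable under
the action of `C`: every indecomposable direct summand of `F X` belongs to the set whenever `X`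
does. -/
structure StableSet (M : TwoRep.{w, u₁, v₁, w₁, u, v} k C) where
  /-- the objects of `M(i)` whose isomorphism class belongs to the set -/
  mem : ∀ i : C, ObjectProperty (M.obj i)
  isIndec : ∀ {i : C} {X : M.obj i}, mem i X → IsIndec X
  of_iso : ∀ {i : C} {X Y : M.obj i}, (X ≅ Y) → mem i X → mem i Y
  stable : ∀ {i j : C} (F : i ⟶ j) {X : M.obj i} {Y : M.obj j}, mem i X → IsIndec Y →
    Nonempty (Retract Y ((M.map F).obj X)) → mem j Y

lemma StableSet.addClosure_map (M : TwoRep.{w, u₁, v₁, w₁, u, v} k C) [hM : M.IsFinitary]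
    (S : M.StableSet) {i j : C} (F : i ⟶ j) {X : M.obj i} (hX : addClosure (S.mem i) X) :
    addClosure (S.mem j) ((M.map F).obj X) :=
  TwoRepTheory.addClosure_map (M.map F) (fun Y hY =>
    addClosure_mono (fun _ hZ => S.stable F hY hZ.1 hZ.2)
      (addClosure_isIndec k (hM.finitary j).finiteDimensional ((M.map F).obj Y))) hX

lemma fullSubcategory_functor_ext {D : Type u} [Category.{v} D] {E : Type u'} [Category.{v'} E]
    {P : ObjectProperty D} {A B : E ⥤ P.FullSubcategory} (h : A ⋙ P.ι = B ⋙ P.ι) : A = B :=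
  CategoryTheory.Functor.ext (fun X => ObjectProperty.FullSubcategory.ext (by exact Functor.congr_obj h X)) (by
    intro X Y f
    apply P.ι.map_injective
    simpa [eqToHom_map] using Functor.congr_hom h f)

/-- The `2`-subrepresentation `M_S` of `M` on the additive closure of a stable set `S`. -/
@[reducible] def sub (M : TwoRep.{w, u₁, v₁, w₁, u, v} k C) [M.IsFinitary] (S : M.StableSet) :
    TwoRep.{w, u₁, v₁, w₁, u, v} k C where
  obj i := (addClosure (S.mem i)).FullSubcategory
  map F := (addClosure (S.mem _)).lift ((addClosure (S.mem _)).ι ⋙ M.map F)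
    fun X => S.addClosure_map M F X.property
  map_additive F := { map_add := by intros; ext; exact (M.map F).map_add }
  map_linear F := { map_smul := by intros; ext; exact (M.map F).map_smul _ _ }
  map₂ α := { app := fun X => ObjectProperty.homMk ((M.map₂ α).app X.obj)
              naturality := by intros; ext; simp }
  map_id i := fullSubcategory_functor_ext (congrArg (fun T => (addClosure (S.mem i)).ι ⋙ T) (M.map_id i))
  map_comp F G := fullSubcategory_functor_ext
    (congrArg (fun T => (addClosure (S.mem _)).ι ⋙ T) (M.map_comp F G))
  map₂_id F := by ext; simp [M.map₂_id]
  map₂_comp α β := by ext; simp [M.map₂_comp]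
  map₂_whiskerLeft F _ _ β := by
    ext X
    simp [M.map₂_whiskerLeft, eqToHom_app]
  map₂_whiskerRight α H := by
    ext X
    simp [M.map₂_whiskerRight, eqToHom_app]

/-! ### Ideals and quotients -/

/-- An ideal of a `2`-representation: an ideal in each category `M(i)`, stable under the action
of `1`-morphisms. (Stability under `2`-morphisms is automatic.) -/
structure Ideal (M : TwoRep.{w, u₁, v₁, w₁, u, v} k C) where
  /-- the morphisms `X ⟶ Y` in the ideal -/
  hom : ∀ {i : C} (X Y : M.obj i), Submodule k (X ⟶ Y)
  comp_left : ∀ {i : C} {X Y Z : M.obj i} (f : X ⟶ Y) {g : Y ⟶ Z}, g ∈ hom Y Z → f ≫ g ∈ hom X Z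
  comp_right : ∀ {i : C} {X Y Z : M.obj i} {f : X ⟶ Y} (g : Y ⟶ Z), f ∈ hom X Y → f ≫ g ∈ hom X Z
  map_mem : ∀ {i j : C} (F : i ⟶ j) {X Y : M.obj i} {f : X ⟶ Y}, f ∈ hom X Y →
    (M.map F).map f ∈ hom ((M.map F).obj X) ((M.map F).obj Y)

namespace Ideal

variable {M : TwoRep.{w, u₁, v₁, w₁, u, v} k C}

instance : LE M.Ideal where
  le I J := ∀ (i : C) (X Y : M.obj i), I.hom X Y ≤ J.hom X Y

/-- The intersection of a set of ideals. -/
def inter (S : Set M.Ideal) : M.Ideal where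
  hom X Y := ⨅ I ∈ S, I.hom X Y
  comp_left f g hg := by
    simp only [Submodule.mem_iInf] at hg ⊢
    exact fun I hI => I.comp_left f (hg I hI)
  comp_right g hf := by
    simp only [Submodule.mem_iInf] at hf ⊢
    exact fun I hI => I.comp_right g (hf I hI)
  map_mem F _ _ f hf := by
    simp only [Submodule.mem_iInf] at hf ⊢
    exact fun I hI => I.map_mem F (hf I hI)

/-- The ideal generated by the identity morphisms of a class of objects. -/
def generatedBy (P : ∀ i : C, ObjectProperty (M.obj i)) : M.Ideal :=
  inter {I | ∀ (i : C) (X : M.obj i), P i X → 𝟙 X ∈ I.hom X X}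

/-- The ideal contains no identity morphism of a nonzero object. -/
def IsProper (I : M.Ideal) : Prop :=
  ∀ (i : C) (X : M.obj i), 𝟙 X ∈ I.hom X X → IsZero X

/-- The sum of a set of ideals, that is, the smallest ideal containing all of them. -/
def sum (S : Set M.Ideal) : M.Ideal := inter {J | ∀ I ∈ S, I ≤ J}

/-- Two parallel morphisms are congruent modulo `I` if their difference lies in `I`. -/
def rel (I : M.Ideal) (i : C) : HomRel (M.obj i) := fun X Y f g => f - g ∈ I.hom X Y

instance (I : M.Ideal) (i : C) : Congruence (I.rel i) where
  comp_left {X Y Z} f {g g'} h := by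
    have := I.comp_left f h
    simpa only [rel, Preadditive.comp_sub] using this
  comp_right {X Y Z f f'} g h := by
    have := I.comp_right g h
    simpa only [rel, Preadditive.sub_comp] using this
  equivalence :=
    { refl := fun f => by simp [rel]
      symm := fun {f g} h => by
        have := neg_mem h
        simpa only [rel, neg_sub] using this
      trans := fun {f g l} h h' => by
        have := add_mem h h'
        simpa only [rel, sub_add_sub_cancel] using this }

instance (I : M.Ideal) (i : C) : Preadditive (CategoryTheory.Quotient (I.rel i)) :=
  CategoryTheory.Quotient.preadditive _ fun {X Y} f₁ f₂ g₁ g₂ h h' => by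
    have := add_mem h h'
    simpa only [rel, add_sub_add_comm] using this

instance (I : M.Ideal) (i : C) : (CategoryTheory.Quotient.functor (I.rel i)).Additive where
  map_add := rfl

instance (I : M.Ideal) (i : C) : Linear k (CategoryTheory.Quotient (I.rel i)) :=
  CategoryTheory.Quotient.linear k _ fun c {X Y} f₁ f₂ h => by
    have := Submodule.smul_mem _ c h
    simpa only [rel, smul_sub] using this

instance (I : M.Ideal) (i : C) : (CategoryTheory.Quotient.functor (I.rel i)).Linear k :=
  { map_smul := fun _ _ => rfl }

instance (I : M.Ideal) (i : C) : HasFiniteBiproducts (CategoryTheory.Quotient (I.rel i)) where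
  out _ :=
    { has_biproduct := fun f =>
        (inferInstance : HasBiproduct fun a => (CategoryTheory.Quotient.functor (I.rel i)).obj (f a).as) }

end Ideal

/-- The quotient `M / I` of a `2`-representation by an ideal. -/
@[reducible] def quotient (M : TwoRep.{w, u₁, v₁, w₁, u, v} k C) (I : M.Ideal) :
    TwoRep.{w, u₁, v₁, w₁, u, v} k C where
  obj i := CategoryTheory.Quotient (I.rel i)
  map {i j} F := CategoryTheory.Quotient.lift (I.rel i) (M.map F ⋙ CategoryTheory.Quotient.functor (I.rel j))
    fun X Y f g h => CategoryTheory.Quotient.sound _ (by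
      have := I.map_mem F h
      simpa only [Ideal.rel, Functor.map_sub] using this)
  map_additive {i j} F :=
    { map_add := by
        rintro ⟨X⟩ ⟨Y⟩ ⟨f⟩ ⟨g⟩
        exact congrArg (CategoryTheory.Quotient.functor (I.rel j)).map (M.map F).map_add }
  map_linear {i j} F :=
    { map_smul := by
        rintro ⟨X⟩ ⟨Y⟩ ⟨f⟩ c
        exact congrArg (CategoryTheory.Quotient.functor (I.rel j)).map
          (Functor.Linear.map_smul (F := M.map F) f c) }
  map₂ {i j F G} α := CategoryTheory.Quotient.natTransLift _ (Functor.whiskerRight (M.map₂ α) (CategoryTheory.Quotient.functor (I.rel j)))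
  map_id i := CategoryTheory.Quotient.lift_unique' _ _ _
    (congrArg (fun T => T ⋙ CategoryTheory.Quotient.functor (I.rel i)) (M.map_id i))
  map_comp F G := CategoryTheory.Quotient.lift_unique' _ _ _
    (congrArg (fun T => T ⋙ CategoryTheory.Quotient.functor (I.rel _)) (M.map_comp F G))
  map₂_id F := by
    apply CategoryTheory.Quotient.natTrans_ext
    ext X
    exact congrArg (CategoryTheory.Quotient.functor (I.rel _)).map
      (NatTrans.congr_app (M.map₂_id F) X)
  map₂_comp α β := by
    apply CategoryTheory.Quotient.natTrans_ext
    ext X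
    exact congrArg (CategoryTheory.Quotient.functor (I.rel _)).map
      (NatTrans.congr_app (M.map₂_comp α β) X)
  map₂_whiskerLeft F _ _ β := by
    apply CategoryTheory.Quotient.natTrans_ext
    ext X
    have h := congrArg (CategoryTheory.Quotient.functor (I.rel _)).map
      (NatTrans.congr_app (M.map₂_whiskerLeft F β) X)
    refine h.trans ?_
    simp only [NatTrans.comp_app, Functor.whiskerLeft_app, eqToHom_app, Functor.map_comp,
      eqToHom_map]
    rfl
  map₂_whiskerRight α H := by
    apply CategoryTheory.Quotient.natTrans_ext
    ext X
    have h := congrArg (CategoryTheory.Quotient.functor (I.rel _)).map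
      (NatTrans.congr_app (M.map₂_whiskerRight α H) X)
    refine h.trans ?_
    simp only [NatTrans.comp_app, Functor.whiskerLeft_app, eqToHom_app, Functor.map_comp,
      eqToHom_map]
    rfl

/-- The ideal of a transitive `2`-representation that defines its simple transitive quotient: the
largest ideal that contains no identity morphisms of nonzero objects, that is, the sum of all
such ideals. -/
def maxIdeal (M : TwoRep.{w, u₁, v₁, w₁, u, v} k C) : M.Ideal :=
  Ideal.sum {I | I.IsProper}

/-- The simple transitive quotient of a transitive `2`-representation. -/
@[reducible] def simpleTransitiveQuotient (M : TwoRep.{w, u₁, v₁, w₁, u, v} k C) :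
    TwoRep.{w, u₁, v₁, w₁, u, v} k C :=
  M.quotient M.maxIdeal

/-- For an object `X` of `M(i)`, the additive closure in `M(j)` of all objects `F X`, where `F` runs
through the `1`-morphisms from `i` to `j`. -/
def generatedObjects (M : TwoRep.{w, u₁, v₁, w₁, u, v} k C) {i : C} (X : M.obj i) (j : C) :
    ObjectProperty (M.obj j) :=
  addClosure fun Y => ∃ F : i ⟶ j, Y = (M.map F).obj X

/-- A `2`-representation is transitive if it is generated, under the action of `1`-morphisms and
additive closure, by each of its nonzero objects. -/
def IsTransitive (M : TwoRep.{w, u₁, v₁, w₁, u, v} k C) : Prop :=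
  ∀ (i : C) (X : M.obj i), ¬ IsZero X → ∀ (j : C) (Y : M.obj j), M.generatedObjects X j Y

/-- The ideal of `M_T` generated by the identities of the objects of `M_S`. -/
def subIdeal (M : TwoRep.{w, u₁, v₁, w₁, u, v} k C) [M.IsFinitary] (S T : M.StableSet) :
    (M.sub T).Ideal :=
  Ideal.generatedBy fun i (X : (addClosure (T.mem i)).FullSubcategory) => addClosure (S.mem i) X.obj

/-- The subquotient `M_T / M_S`, for stable sets `S ⊆ T`: the quotient of `M_T` by the ideal
generated by the identities of the objects of `M_S`. -/
@[reducible] def subquotient (M : TwoRep.{w, u₁, v₁, w₁, u, v} k C) [M.IsFinitary] (S T : M.StableSet) :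
    TwoRep.{w, u₁, v₁, w₁, u, v} k C :=
  (M.sub T).quotient (M.subIdeal S T)

/-- A nonzero transitive subquotient `M_T / M_S` of `M`, given by stable sets `S ⊊ T`. -/
structure TransitiveSubquotient (M : TwoRep.{w, u₁, v₁, w₁, u, v} k C) [M.IsFinitary] where
  /-- the smaller stable set -/
  bot : M.StableSet
  /-- the larger stable set -/
  top : M.StableSet
  le : ∀ (i : C) (X : M.obj i), bot.mem i X → top.mem i X
  ne : ∃ (i : C) (X : M.obj i), top.mem i X ∧ ¬ bot.mem i X
  isTransitive : (M.subquotient bot top).IsTransitive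

/-- The simple transitive subquotient of `M` attached to a transitive subquotient `M_T / M_S`. -/
@[reducible] def TransitiveSubquotient.simple {M : TwoRep.{w, u₁, v₁, w₁, u, v} k C} [M.IsFinitary]
    (Q : M.TransitiveSubquotient) : TwoRep.{w, u₁, v₁, w₁, u, v} k C :=
  (M.subquotient Q.bot Q.top).simpleTransitiveQuotient

/-- A finitary `2`-representation is isotypic if all its simple transitive subquotients are
equivalent. -/
def IsIsotypic (M : TwoRep.{w, u₁, v₁, w₁, u, v} k C) [M.IsFinitary] : Prop :=
  ∀ Q Q' : M.TransitiveSubquotient, Equivalent Q.simple Q'.simple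

end TwoRep

/-! ### Tensor products of linear categories and inflations -/

section Tensor

/-- The objects `X ⊠ Y`, with `X` in `D` and `Y` in `E`, of the tensor product over `k`. -/
@[ext]
structure PureTensor (k : Type w) (D : Type u) (E : Type u') : Type (max u u') where
  /-- the first factor -/
  fst : D
  /-- the second factor -/
  snd : E

variable {k : Type w} [Field k] {D : Type u} [Category.{v} D] [Preadditive D] [Linear k D]
  {E : Type u'} [Category.{v'} E] [Preadditive E] [Linear k E]

namespace PureTensor

/-- `Hom (X ⊠ Y, U ⊠ V) = Hom (X, U) ⊗ Hom (Y, V)`. -/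
abbrev Hom (X Y : PureTensor k D E) : Type (max v v') :=
  TensorProduct k (X.fst ⟶ Y.fst) (X.snd ⟶ Y.snd)

/-- Composition, given by `(f ⊗ g) ≫ (f' ⊗ g') = (f ≫ f') ⊗ (g ≫ g')`. -/
def compMap (X Y Z : PureTensor k D E) : Hom X Y →ₗ[k] Hom Y Z →ₗ[k] Hom X Z :=
  TensorProduct.map₂ (Linear.comp X.fst Y.fst Z.fst) (Linear.comp X.snd Y.snd Z.snd)

@[simp]
lemma compMap_tmul {X Y Z : PureTensor k D E} (f : X.fst ⟶ Y.fst) (g : X.snd ⟶ Y.snd)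
    (f' : Y.fst ⟶ Z.fst) (g' : Y.snd ⟶ Z.snd) :
    compMap X Y Z (f ⊗ₜ[k] g) (f' ⊗ₜ[k] g') = (f ≫ f') ⊗ₜ[k] (g ≫ g') := rfl

instance : Category.{max v v'} (PureTensor k D E) where
  Hom X Y := Hom X Y
  id X := 𝟙 X.fst ⊗ₜ[k] 𝟙 X.snd
  comp {X Y Z} f g := compMap X Y Z f g
  id_comp {X Y} f := by
    induction f using TensorProduct.induction_on with
    | zero => simp
    | tmul f g => simp
    | add a b ha hb => rw [map_add, ha, hb]
  comp_id {X Y} f := by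
    induction f using TensorProduct.induction_on with
    | zero => simp
    | tmul f g => simp
    | add a b ha hb => rw [map_add, LinearMap.add_apply, ha, hb]
  assoc {W X Y Z} f g h := by
    induction f using TensorProduct.induction_on with
    | zero => simp
    | add a b ha hb => simp only [map_add, LinearMap.add_apply, ha, hb]
    | tmul f f' =>
      induction g using TensorProduct.induction_on with
      | zero => simp
      | add a b ha hb => simp only [map_add, LinearMap.add_apply, ha, hb]
      | tmul g g' =>
        induction h using TensorProduct.induction_on with
        | zero => simp
        | add a b ha hb => simp only [map_add, ha, hb]
        | tmul h h' => simp

instance : Preadditive (PureTensor k D E) where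
  homGroup X Y := inferInstanceAs (AddCommGroup (Hom X Y))
  add_comp X Y Z f g h := LinearMap.map_add₂ (compMap X Y Z) f g h
  comp_add X Y Z f g h := LinearMap.map_add (compMap X Y Z f) g h

instance : Linear k (PureTensor k D E) where
  homModule X Y := inferInstanceAs (Module k (Hom X Y))
  smul_comp X Y Z c f g := LinearMap.map_smul₂ (compMap X Y Z) c f g
  comp_smul X Y Z f c g := LinearMap.map_smul (compMap X Y Z f) c g

end PureTensor

instance {B : Type u} [Category.{v} B] [Preadditive B] [Linear k B] : Linear k (Mat_ B) where
  homModule M N := inferInstanceAs (Module k (∀ (i : M.ι) (j : N.ι), M.X i ⟶ N.X j))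
  smul_comp X Y Z c f g := by
    ext i j
    change ∑ l, (c • f i l) ≫ g l j = c • ∑ l, f i l ≫ g l j
    simp [Finset.smul_sum]
  comp_smul X Y Z f c g := by
    ext i j
    change ∑ l, f i l ≫ (c • g l j) = c • ∑ l, f i l ≫ g l j
    simp [Finset.smul_sum]

variable (k D E) in
/-- The tensor product `D ⊠ E`: finite formal direct sums of objects `X ⊠ Y`, with matrices of
elements of the spaces `Hom (X, U) ⊗ Hom (Y, V)` as morphisms. -/
abbrev Boxtimes : Type (max 1 u u') := Mat_ (PureTensor k D E)

namespace PureTensor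

lemma comp_tmul {X Y Z : PureTensor k D E} (f : X.fst ⟶ Y.fst) (g : X.snd ⟶ Y.snd)
    (f' : Y.fst ⟶ Z.fst) (g' : Y.snd ⟶ Z.snd) :
    (show X ⟶ Y from f ⊗ₜ[k] g) ≫ (show Y ⟶ Z from f' ⊗ₜ[k] g') = (f ≫ f') ⊗ₜ[k] (g ≫ g') := rfl

lemma hom_induction {X Y : PureTensor k D E} {P : (X ⟶ Y) → Prop} (zero : P 0)
    (tmul : ∀ (f : X.fst ⟶ Y.fst) (g : X.snd ⟶ Y.snd), P (f ⊗ₜ[k] g))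
    (add : ∀ a b, P a → P b → P (a + b)) (f : X ⟶ Y) : P f :=
  TensorProduct.induction_on (motive := P) f zero tmul add

variable {D₁ : Type u} [Category.{v} D₁] [Preadditive D₁] [Linear k D₁]
  {D₂ : Type u} [Category.{v} D₂] [Preadditive D₂] [Linear k D₂]

/-- `F ⊠ Id` on morphisms: `f ⊗ g ↦ F f ⊗ g`. -/
def mapHom (F : D₁ ⥤ D₂) [F.Additive] [F.Linear k] (X Y : PureTensor k D₁ E) :
    Hom X Y →ₗ[k] Hom (⟨F.obj X.fst, X.snd⟩ : PureTensor k D₂ E) ⟨F.obj Y.fst, Y.snd⟩ :=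
  (F.mapLinearMap k).rTensor (X.snd ⟶ Y.snd)

/-- The functor `F ⊠ Id` on objects `X ⊠ Y`. -/
def map (F : D₁ ⥤ D₂) [F.Additive] [F.Linear k] : PureTensor k D₁ E ⥤ PureTensor k D₂ E where
  obj X := ⟨F.obj X.fst, X.snd⟩
  map {X Y} f := mapHom F X Y f
  map_id X := by
    change F.map (𝟙 X.fst) ⊗ₜ[k] 𝟙 X.snd = _
    rw [F.map_id]; rfl
  map_comp {X Y Z} f g := by
    induction f using hom_induction with
    | zero =>
      rw [zero_comp, LinearMap.map_zero, LinearMap.map_zero]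
      exact (LinearMap.map_zero₂ (compMap _ _ _) _).symm
    | add a b ha hb =>
      rw [Preadditive.add_comp, LinearMap.map_add, LinearMap.map_add, ha, hb]
      exact (Preadditive.add_comp _ _ _ _ _ _).symm
    | tmul f f' =>
      induction g using hom_induction with
      | zero =>
        rw [comp_zero, LinearMap.map_zero, LinearMap.map_zero]
        exact (LinearMap.map_zero (compMap _ _ _ _)).symm
      | add a b ha hb =>
        rw [Preadditive.comp_add, LinearMap.map_add, LinearMap.map_add, ha, hb]
        exact (Preadditive.comp_add _ _ _ _ _ _).symm
      | tmul g g' =>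
        change F.map (f ≫ g) ⊗ₜ[k] (f' ≫ g') = (F.map f ≫ F.map g) ⊗ₜ[k] (f' ≫ g')
        rw [F.map_comp]

instance (F : D₁ ⥤ D₂) [F.Additive] [F.Linear k] : (map F : PureTensor k D₁ E ⥤ _).Additive where
  map_add {X Y f g} := LinearMap.map_add (mapHom F X Y) f g

instance (F : D₁ ⥤ D₂) [F.Additive] [F.Linear k] : (map F : PureTensor k D₁ E ⥤ _).Linear k where
  map_smul {X Y} f c := LinearMap.map_smul (mapHom F X Y) c f

/-- The natural transformation `α ⊠ id` on objects `X ⊠ Y`, with components `α_X ⊗ id_Y`. -/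
def mapNat {F G : D₁ ⥤ D₂} [F.Additive] [F.Linear k] [G.Additive] [G.Linear k] (α : F ⟶ G) :
    (map F : PureTensor k D₁ E ⥤ PureTensor k D₂ E) ⟶ map G where
  app X := α.app X.fst ⊗ₜ[k] 𝟙 X.snd
  naturality {X Y} f := by
    induction f using hom_induction with
    | zero => rw [Functor.map_zero, Functor.map_zero, zero_comp, comp_zero]
    | add a b ha hb =>
      rw [Functor.map_add, Functor.map_add, Preadditive.add_comp, Preadditive.comp_add, ha, hb]
    | tmul f g =>
      change (F.map f ≫ α.app Y.fst) ⊗ₜ[k] (g ≫ 𝟙 Y.snd) =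
        (α.app X.fst ≫ G.map f) ⊗ₜ[k] (𝟙 X.snd ≫ g)
      rw [α.naturality, Category.comp_id, Category.id_comp]

variable {D₃ : Type u} [Category.{v} D₃] [Preadditive D₃] [Linear k D₃]

lemma map_id_eq : map (k := k) (E := E) (𝟭 D₁) = 𝟭 _ :=
  Functor.hext (fun _ => rfl) fun X Y f => heq_of_eq (DFunLike.congr_fun
    (LinearMap.rTensor_id (R := k) (X.snd ⟶ Y.snd) (X.fst ⟶ Y.fst)) f)

lemma map_comp_eq (F : D₁ ⥤ D₂) [F.Additive] [F.Linear k] (G : D₂ ⥤ D₃) [G.Additive]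
    [G.Linear k] : map (k := k) (E := E) (F ⋙ G) = map F ⋙ map G :=
  Functor.hext (fun _ => rfl) fun X Y f => heq_of_eq (LinearMap.rTensor_comp_apply (R := k)
    (X.snd ⟶ Y.snd) (G.mapLinearMap k) (F.mapLinearMap k) f)

lemma mapNat_id (F : D₁ ⥤ D₂) [F.Additive] [F.Linear k] :
    mapNat (k := k) (E := E) (𝟙 F) = 𝟙 (map F) := rfl

lemma mapNat_comp {F G H : D₁ ⥤ D₂} [F.Additive] [F.Linear k] [G.Additive] [G.Linear k]
    [H.Additive] [H.Linear k] (α : F ⟶ G) (β : G ⟶ H) :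
    mapNat (k := k) (E := E) (α ≫ β) = mapNat α ≫ mapNat β := by
  refine NatTrans.ext (funext fun X => ?_)
  change (α.app X.fst ≫ β.app X.fst) ⊗ₜ[k] 𝟙 X.snd =
    (α.app X.fst ≫ β.app X.fst) ⊗ₜ[k] (𝟙 X.snd ≫ 𝟙 X.snd)
  rw [Category.comp_id]

lemma mapNat_whiskerLeft (F : D₁ ⥤ D₂) [F.Additive] [F.Linear k] {G H : D₂ ⥤ D₃} [G.Additive]
    [G.Linear k] [H.Additive] [H.Linear k] (α : G ⟶ H) :
    mapNat (k := k) (E := E) (Functor.whiskerLeft F α) = eqToHom (map_comp_eq F G) ≫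
      Functor.whiskerLeft (map F) (mapNat α) ≫ eqToHom (map_comp_eq F H).symm := by
  refine NatTrans.ext (funext fun X => ?_)
  rw [NatTrans.comp_app, NatTrans.comp_app, eqToHom_app, eqToHom_app]
  exact ((Category.id_comp _).trans (Category.comp_id _)).symm

lemma mapNat_whiskerRight {F G : D₁ ⥤ D₂} [F.Additive] [F.Linear k] [G.Additive] [G.Linear k]
    (α : F ⟶ G) (H : D₂ ⥤ D₃) [H.Additive] [H.Linear k] :
    mapNat (k := k) (E := E) (Functor.whiskerRight α H) = eqToHom (map_comp_eq F H) ≫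
      Functor.whiskerRight (mapNat α) (map H) ≫ eqToHom (map_comp_eq G H).symm := by
  refine NatTrans.ext (funext fun X => ?_)
  rw [NatTrans.comp_app, NatTrans.comp_app, eqToHom_app, eqToHom_app]
  exact ((Category.id_comp _).trans (Category.comp_id _)).symm

end PureTensor

section Mat

variable {A : Type u} [Category.{v} A] [Preadditive A] {B : Type u'} [Category.{v} B]
  [Preadditive B] {A' : Type u''} [Category.{v} A'] [Preadditive A']

/-- A natural transformation of additive functors, applied diagonally to formal direct sums. -/
def matNat {F G : A ⥤ B} [F.Additive] [G.Additive] (α : F ⟶ G) :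
    F.mapMat_ ⟶ G.mapMat_ where
  app X := fun i j => α.app (X.X i) ≫ G.map ((𝟙 X : X ⟶ X) i j)
  naturality {X Y} f := by
    funext i j
    change ∑ l : Y.ι, F.map (f i l) ≫ (α.app (Y.X l) ≫ G.map ((𝟙 Y : Y ⟶ Y) l j)) =
      ∑ l : X.ι, (α.app (X.X i) ≫ G.map ((𝟙 X : X ⟶ X) i l)) ≫ G.map (f l j)
    have h : ∑ l : Y.ι, f i l ≫ (𝟙 Y : Y ⟶ Y) l j = ∑ l : X.ι, (𝟙 X : X ⟶ X) i l ≫ f l j :=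
      congrFun (congrFun ((Category.comp_id f).trans (Category.id_comp f).symm) i) j
    have h' := congrArg (fun t => α.app (X.X i) ≫ G.map t) h
    simpa only [Functor.map_sum, Functor.map_comp, Preadditive.comp_sum, Category.assoc,
      NatTrans.naturality_assoc] using h'

lemma mapMat_id_apply (F : A ⥤ B) [F.Additive] (X : Mat_ A) (i j : X.ι) :
    F.map ((𝟙 X : X ⟶ X) i j) = (𝟙 (F.mapMat_.obj X) : F.mapMat_.obj X ⟶ F.mapMat_.obj X) i j :=
  congrFun (congrFun (F.mapMat_.map_id X) i) j

lemma matNat_id (F : A ⥤ B) [F.Additive] : matNat (𝟙 F) = 𝟙 F.mapMat_ := by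
  refine NatTrans.ext (funext fun X => funext fun i => funext fun j => ?_)
  exact (Category.id_comp _).trans (mapMat_id_apply F X i j)

lemma matNat_comp {F G H : A ⥤ B} [F.Additive] [G.Additive] [H.Additive] (α : F ⟶ G)
    (β : G ⟶ H) : matNat (α ≫ β) = matNat α ≫ matNat β := by
  refine NatTrans.ext (funext fun X => funext fun i => funext fun j => ?_)
  change (α ≫ β).app (X.X i) ≫ H.map ((𝟙 X : X ⟶ X) i j) =
    ∑ l : X.ι, (α.app (X.X i) ≫ G.map ((𝟙 X : X ⟶ X) i l)) ≫
      (β.app (X.X l) ≫ H.map ((𝟙 X : X ⟶ X) l j))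
  have h : (𝟙 X : X ⟶ X) i j = ∑ l : X.ι, (𝟙 X : X ⟶ X) i l ≫ (𝟙 X : X ⟶ X) l j :=
    congrFun (congrFun (Category.comp_id (𝟙 X)).symm i) j
  rw [h]
  simp only [Functor.map_sum, Functor.map_comp, Preadditive.comp_sum, Category.assoc,
    NatTrans.naturality_assoc, NatTrans.comp_app]

lemma matNat_whiskerLeft (F : A ⥤ B) [F.Additive] {G H : B ⥤ A'} [G.Additive] [H.Additive]
    (α : G ⟶ H) :
    matNat (Functor.whiskerLeft F α) = Functor.whiskerLeft F.mapMat_ (matNat α) := by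
  refine NatTrans.ext (funext fun X => funext fun i => funext fun j => ?_)
  exact congrArg (fun t => α.app (F.obj (X.X i)) ≫ H.map t) (mapMat_id_apply F X i j)

lemma matNat_whiskerRight {F G : A ⥤ B} [F.Additive] [G.Additive] (α : F ⟶ G) (H : B ⥤ A')
    [H.Additive] :
    matNat (Functor.whiskerRight α H) = Functor.whiskerRight (matNat α) H.mapMat_ := by
  refine NatTrans.ext (funext fun X => funext fun i => funext fun j => ?_)
  exact (H.map_comp (α.app (X.X i)) (G.map ((𝟙 X : X ⟶ X) i j))).symm

lemma mapMat_congr {F G : A ⥤ B} [F.Additive] [G.Additive] (h : F = G) :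
    F.mapMat_ = G.mapMat_ := by
  subst h; rfl

lemma matNat_eqToHom {F G : A ⥤ B} [F.Additive] [G.Additive] (h : F = G) :
    matNat (eqToHom h) = eqToHom (mapMat_congr h) := by
  subst h; exact matNat_id F

end Mat

section

variable {D₁ : Type u} [Category.{v} D₁] [Preadditive D₁] [Linear k D₁]
  {D₂ : Type u} [Category.{v} D₂] [Preadditive D₂] [Linear k D₂]

variable (k E) in
/-- The functor `F ⊠ Id`. -/
@[reducible] def boxMap (F : D₁ ⥤ D₂) [F.Additive] [F.Linear k] : Boxtimes k D₁ E ⥤ Boxtimes k D₂ E :=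
  (PureTensor.map F : PureTensor k D₁ E ⥤ PureTensor k D₂ E).mapMat_

instance (F : D₁ ⥤ D₂) [F.Additive] [F.Linear k] : (boxMap k E F).Additive where
  map_add := by
    intro X Y f g
    ext i j
    exact LinearMap.map_add (PureTensor.mapHom F (X.X i) (Y.X j)) (f i j) (g i j)

instance (F : D₁ ⥤ D₂) [F.Additive] [F.Linear k] : (boxMap k E F).Linear k where
  map_smul := by
    intro X Y f c
    ext i j
    exact LinearMap.map_smul (PureTensor.mapHom F (X.X i) (Y.X j)) c (f i j)

variable (k E) in
/-- The natural transformation `α ⊠ id`. -/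
def boxNat {F G : D₁ ⥤ D₂} [F.Additive] [F.Linear k] [G.Additive] [G.Linear k] (α : F ⟶ G) :
    boxMap k E F ⟶ boxMap k E G :=
  matNat (PureTensor.mapNat (k := k) (E := E) α)

lemma boxMap_id : boxMap k E (𝟭 D₁) = 𝟭 (Boxtimes k D₁ E) :=
  mapMat_congr (F := PureTensor.map (𝟭 D₁)) (G := 𝟭 _) PureTensor.map_id_eq

lemma boxMap_comp {D₃ : Type u} [Category.{v} D₃] [Preadditive D₃] [Linear k D₃]
    (F : D₁ ⥤ D₂) [F.Additive] [F.Linear k] (G : D₂ ⥤ D₃) [G.Additive] [G.Linear k] :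
    boxMap k E (F ⋙ G) = boxMap k E F ⋙ boxMap k E G :=
  mapMat_congr (G := PureTensor.map F ⋙ PureTensor.map G) (PureTensor.map_comp_eq F G)

lemma boxNat_id (F : D₁ ⥤ D₂) [F.Additive] [F.Linear k] :
    boxNat k E (𝟙 F) = 𝟙 (boxMap k E F) := by
  rw [boxNat, PureTensor.mapNat_id, matNat_id]

lemma boxNat_comp {F G H : D₁ ⥤ D₂} [F.Additive] [F.Linear k] [G.Additive] [G.Linear k]
    [H.Additive] [H.Linear k] (α : F ⟶ G) (β : G ⟶ H) :
    boxNat k E (α ≫ β) = boxNat k E α ≫ boxNat k E β := by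
  rw [boxNat, PureTensor.mapNat_comp, matNat_comp]; rfl

lemma boxMap_congr {F G : D₁ ⥤ D₂} [F.Additive] [F.Linear k] [G.Additive] [G.Linear k]
    (h : F = G) : boxMap k E F = boxMap k E G := by
  subst h; rfl

lemma boxNat_eqToHom {F G : D₁ ⥤ D₂} [F.Additive] [F.Linear k] [G.Additive] [G.Linear k]
    (h : F = G) : boxNat k E (eqToHom h) = eqToHom (boxMap_congr h) := by
  subst h; exact boxNat_id F

lemma boxNat_whiskerLeft {D₃ : Type u} [Category.{v} D₃] [Preadditive D₃] [Linear k D₃]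
    (F : D₁ ⥤ D₂) [F.Additive] [F.Linear k] {G H : D₂ ⥤ D₃} [G.Additive] [G.Linear k]
    [H.Additive] [H.Linear k] (α : G ⟶ H) :
    boxNat k E (Functor.whiskerLeft F α) = eqToHom (boxMap_comp F G) ≫
      Functor.whiskerLeft (boxMap k E F) (boxNat k E α) ≫ eqToHom (boxMap_comp F H).symm := by
  rw [boxNat, PureTensor.mapNat_whiskerLeft, matNat_comp, matNat_comp, matNat_eqToHom,
    matNat_eqToHom, matNat_whiskerLeft]
  rfl

lemma boxNat_whiskerRight {D₃ : Type u} [Category.{v} D₃] [Preadditive D₃] [Linear k D₃]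
    {F G : D₁ ⥤ D₂} [F.Additive] [F.Linear k] [G.Additive] [G.Linear k] (α : F ⟶ G)
    (H : D₂ ⥤ D₃) [H.Additive] [H.Linear k] :
    boxNat k E (Functor.whiskerRight α H) = eqToHom (boxMap_comp F H) ≫
      Functor.whiskerRight (boxNat k E α) (boxMap k E H) ≫ eqToHom (boxMap_comp G H).symm := by
  rw [boxNat, PureTensor.mapNat_whiskerRight, matNat_comp, matNat_comp, matNat_eqToHom,
    matNat_eqToHom, matNat_whiskerRight]
  rfl

end

end Tensor

/-- The `E`-inflation of a `2`-representation `M`: it sends `i` to `M(i) ⊠ E`, a `1`-morphism `F` to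
`M(F) ⊠ Id` and a `2`-morphism `α` to `M(α) ⊠ id`. -/
@[reducible] def TwoRep.inflation {k : Type w} [Field k] {C : Type u₁} [Bicategory.{w₁, v₁} C]
    (M : TwoRep.{w, u₁, v₁, w₁, u, v} k C) (E : Type u') [Category.{v'} E] [Preadditive E]
    [Linear k E] : TwoRep.{w, u₁, v₁, w₁, max 1 u u', max v v'} k C where
  obj i := Boxtimes k (M.obj i) E
  map F := boxMap k E (M.map F)
  map₂ α := boxNat k E (M.map₂ α)
  map_id i := (boxMap_congr (M.map_id i)).trans boxMap_id
  map_comp F G := (boxMap_congr (M.map_comp F G)).trans (boxMap_comp _ _)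
  map₂_id F := by rw [M.map₂_id, boxNat_id]
  map₂_comp α β := by rw [M.map₂_comp, boxNat_comp]
  map₂_whiskerLeft F _ _ β := by
    rw [M.map₂_whiskerLeft, boxNat_comp, boxNat_comp, boxNat_eqToHom, boxNat_eqToHom,
      boxNat_whiskerLeft]
    simp
  map₂_whiskerRight α H := by
    rw [M.map₂_whiskerRight, boxNat_comp, boxNat_comp, boxNat_eqToHom, boxNat_eqToHom,
      boxNat_whiskerRight]
    simp

end TwoRepTheory

end

/-!
Over an algebraically closed field an indecomposable object `Y` of a finitary category has a local
endomorphism algebra with residue field `k`: there is an algebra homomorphism `χ : End Y → k` that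
detects isomorphisms and has nilpotent kernel (`IsIndec.exists_residue`). Consequently
`f ⊗ g ↦ χ g • f` (`PureTensor.eval`) is a functor from the full subcategory of the objects `X ⊠ Y`
to the category of the objects `X`, and it reflects isomorphisms among endomorphisms, because its
kernel on `End (X ⊠ Y)` is nilpotent (`PureTensor.isIso_of_isIso_eval`). In particular `X ⊠ Y` is
local for indecomposable `X`, so the indecomposable objects of `M(i) ⊠ A` are the `X ⊠ Y` with `X`
and `Y` indecomposable, and the inflation is finitary (`isFinitaryCategory_boxtimes`).

The action of `C` does not change the second factor. As `M` is transitive, a stable set of the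
inflation therefore contains with one `X ⊠ Y` all `X' ⊠ Y` (`StableSet.mem_box_of_mem_box`), and a
transitive subquotient contains up to isomorphism only one `Y` (`nonempty_iso_of_isTransitive`).
Hence `Θ : X ↦ X ⊠ Y` is an essentially surjective `2`-natural transformation from `M` to the
subquotient (`essSurj_tensProj`).

The largest proper ideal of a `2`-representation consists of those `f` for which no composite
`Z ⟶ F X ⟶ F X' ⟶ Z` through `F f` is invertible, where `Z` runs through a class of local objects
such that every nonzero object has a retract in it (`mem_maxIdeal_iff`). Since evaluation at `χ` is
compatible with the action and preserves and reflects automorphisms, a morphism `X ⊠ Y ⟶ X' ⊠ Y`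
belongs to the largest proper ideal of the subquotient if and only if its evaluation belongs to that
of `M` (`tensProjHom_mem_maxIdeal_iff`). So `Θ` induces a faithful functor on simple transitive
quotients. It is also full, as a morphism `t` differs from `Θ (eval t)` by a morphism with
evaluation zero. Thus every simple transitive subquotient of the inflation is equivalent to the
simple transitive quotient of `M`, and isotypy follows as equivalence is symmetric and transitive.
-/

noncomputable section

namespace TwoRepTheory

/-! ### Direct sums of objects with local endomorphism rings -/

section KrullSchmidt

variable {D : Type u} [Category.{v} D] [Preadditive D]

/-- Data exhibiting `Z` as the direct sum of `X` and `Y`. The mixed composites are not required to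
vanish, since this follows from the equations given. -/
structure Splitting (Z X Y : D) where
  /-- the inclusion of the first summand -/
  inl : X ⟶ Z
  /-- the inclusion of the second summand -/
  inr : Y ⟶ Z
  /-- the projection to the first summand -/
  fst : Z ⟶ X
  /-- the projection to the second summand -/
  snd : Z ⟶ Y
  inl_fst : inl ≫ fst = 𝟙 X
  inr_snd : inr ≫ snd = 𝟙 Y
  total : fst ≫ inl + snd ≫ inr = 𝟙 Z

namespace Splitting

attribute [simp] inl_fst inr_snd

variable {Z X Y : D} (s : Splitting Z X Y)

@[simp]
lemma inl_fst_assoc {W : D} (f : X ⟶ W) : s.inl ≫ s.fst ≫ f = f := by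
  rw [← Category.assoc, s.inl_fst, Category.id_comp]

@[simp]
lemma inr_snd_assoc {W : D} (f : Y ⟶ W) : s.inr ≫ s.snd ≫ f = f := by
  rw [← Category.assoc, s.inr_snd, Category.id_comp]

@[simp]
lemma inl_snd : s.inl ≫ s.snd = 0 := by
  have h := congrArg (fun t => s.inl ≫ t ≫ s.snd) s.total
  simpa using h

@[simp]
lemma inr_fst : s.inr ≫ s.fst = 0 := by
  have h := congrArg (fun t => s.inr ≫ t ≫ s.fst) s.total
  simpa using h

@[simp]
lemma inl_snd_assoc {W : D} (f : Y ⟶ W) : s.inl ≫ s.snd ≫ f = 0 := by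
  rw [← Category.assoc, s.inl_snd, zero_comp]

@[simp]
lemma inr_fst_assoc {W : D} (f : X ⟶ W) : s.inr ≫ s.fst ≫ f = 0 := by
  rw [← Category.assoc, s.inr_fst, zero_comp]

/-- The first summand as a retract. -/
def retractFst : Retract X Z := ⟨s.inl, s.fst, s.inl_fst⟩

/-- The second summand as a retract. -/
def retractSnd : Retract Y Z := ⟨s.inr, s.snd, s.inr_snd⟩

/-- Splittings are preserved by additive functors. -/
def map {E : Type u'} [Category.{v'} E] [Preadditive E] (F : D ⥤ E) [F.Additive] :
    Splitting (F.obj Z) (F.obj X) (F.obj Y) where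
  inl := F.map s.inl
  inr := F.map s.inr
  fst := F.map s.fst
  snd := F.map s.snd
  inl_fst := by rw [← F.map_comp, s.inl_fst, F.map_id]
  inr_snd := by rw [← F.map_comp, s.inr_snd, F.map_id]
  total := by rw [← F.map_comp, ← F.map_comp, ← F.map_add, s.total, F.map_id]

/-- Direct sums of isomorphic objects are isomorphic. -/
def iso {Z' X' Y' : D} (s' : Splitting Z' X' Y') (e : X ≅ X') (e' : Y ≅ Y') : Z ≅ Z' where
  hom := s.fst ≫ e.hom ≫ s'.inl + s.snd ≫ e'.hom ≫ s'.inr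
  inv := s'.fst ≫ e.inv ≫ s.inl + s'.snd ≫ e'.inv ≫ s.inr
  hom_inv_id := by simp [s.total]
  inv_hom_id := by simp [s'.total]

variable (X Y) in
/-- The splitting of a biproduct. -/
def ofBiprod [HasBinaryBiproducts D] : Splitting (X ⊞ Y) X Y :=
  ⟨biprod.inl, biprod.inr, biprod.fst, biprod.snd, by simp, by simp, biprod.total⟩

/-- The splitting of an object isomorphic to a direct sum. -/
def ofIso {W : D} (e : W ≅ Z) : Splitting W X Y where
  inl := s.inl ≫ e.inv
  inr := s.inr ≫ e.inv
  fst := e.hom ≫ s.fst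
  snd := e.hom ≫ s.snd
  inl_fst := by simp
  inr_snd := by simp
  total := by
    have h := congrArg (fun t => e.hom ≫ t ≫ e.inv) s.total
    simpa using h

/-- Associativity of direct sums. -/
def assoc {X₁ X₂ W : D} (s' : Splitting X X₁ X₂) (t : Splitting W X₂ Y) : Splitting Z X₁ W where
  inl := s'.inl ≫ s.inl
  inr := t.fst ≫ s'.inr ≫ s.inl + t.snd ≫ s.inr
  fst := s.fst ≫ s'.fst
  snd := s.fst ≫ s'.snd ≫ t.inl + s.snd ≫ t.inr
  inl_fst := by simp
  inr_snd := by simp [t.total]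
  total := by
    have h := congrArg (fun t => s.fst ≫ t ≫ s.inl) s'.total
    simp only [Preadditive.add_comp, Preadditive.comp_add, Category.assoc, Category.id_comp] at h
    simp [← add_assoc, h, s.total]

/-- A direct sum with zero first summand. -/
lemma nonempty_zero_left (hX : IsZero X) (Y : D) : Nonempty (Splitting Y X Y) :=
  ⟨⟨0, 𝟙 Y, 0, 𝟙 Y, hX.eq_of_src _ _, by simp, by simp⟩⟩

/-- A direct sum with zero second summand. -/
lemma nonempty_zero_right (X : D) (hY : IsZero Y) : Nonempty (Splitting X X Y) :=
  ⟨⟨𝟙 X, 0, 𝟙 X, 0, by simp, hY.eq_of_src _ _, by simp⟩⟩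

end Splitting

/-- Finite direct sums of objects with property `P`, built by adding one summand at a time. -/
inductive SumOf (P : ObjectProperty D) : D → Prop
  | zero {Z : D} (h : IsZero Z) : SumOf P Z
  | cons {Z X Y : D} (hX : P X) (hY : SumOf P Y) (s : Splitting Z X Y) : SumOf P Z

namespace SumOf

variable {P Q : ObjectProperty D}

lemma of_iso {X Y : D} (h : SumOf P X) (e : Y ≅ X) : SumOf P Y := by
  cases h with
  | zero h => exact .zero (h.of_iso e)
  | cons hX hY s => exact .cons hX hY (s.ofIso e)

lemma of_mem [HasZeroObject D] {X : D} (h : P X) : SumOf P X :=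
  .cons h (.zero (isZero_zero D)) (Splitting.nonempty_zero_right X (isZero_zero D)).some

lemma append [HasBinaryBiproducts D] {Z X Y : D} (hX : SumOf P X) (hY : SumOf P Y)
    (s : Splitting Z X Y) : SumOf P Z := by
  induction hX generalizing Z with
  | zero h =>
    exact hY.of_iso (s.iso (Splitting.nonempty_zero_left h Y).some (Iso.refl _) (Iso.refl _))
  | cons h₁ _ t ih =>
    exact .cons h₁ (ih (Splitting.ofBiprod _ Y)) (s.assoc t (Splitting.ofBiprod _ Y))

lemma biproduct [HasFiniteBiproducts D] [HasBinaryBiproducts D] {ι : Type} [Finite ι] (f : ι → D)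
    (hf : ∀ a, SumOf P (f a)) : SumOf P (⨁ f) := by
  obtain ⟨n, ⟨e⟩⟩ := Finite.exists_equiv_fin ι
  suffices h : ∀ (n : ℕ) (f : Fin n → D), (∀ a, SumOf P (f a)) → SumOf P (⨁ f) by
    refine (h n (f ∘ e.symm) fun a => hf _).of_iso ?_
    exact biproduct.whiskerEquiv e (fun j => eqToIso (by simp))
  intro n
  induction n with
  | zero =>
    intro f _
    refine .zero ((IsZero.iff_id_eq_zero _).2 ?_)
    ext a
    exact a.elim0
  | succ n ih =>
    intro f hf
    refine append (hf 0) (ih (fun a => f a.succ) fun a => hf _)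
      ⟨biproduct.ι f 0, biproduct.desc fun a => biproduct.ι f a.succ, biproduct.π f 0,
        biproduct.lift fun a => biproduct.π f a.succ, by simp, ?_, ?_⟩
    · ext a b
      by_cases h : a = b
      · subst h; simp
      · have h' : b.succ ≠ a.succ := fun h' => h (Fin.succ_injective _ h').symm
        simp [biproduct.ι_π_ne f h', biproduct.ι_π_ne (fun a : Fin n => f a.succ) (Ne.symm h)]
    · rw [biproduct.lift_desc, ← Fin.sum_univ_succ (fun a => biproduct.π f a ≫ biproduct.ι f a)]
      exact biproduct.total

lemma map {E : Type u'} [Category.{v'} E] [Preadditive E] (F : D ⥤ E) [F.Additive]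
    {Q : ObjectProperty E} (h : ∀ X, P X → Q (F.obj X)) {X : D} (hX : SumOf P X) :
    SumOf Q (F.obj X) := by
  induction hX with
  | zero h => exact .zero (F.map_isZero h)
  | cons hX _ s ih => exact .cons (h _ hX) ih (s.map F)

lemma bind [HasBinaryBiproducts D] (h : ∀ X, P X → SumOf Q X) {X : D} (hX : SumOf P X) :
    SumOf Q X := by
  induction hX with
  | zero h => exact .zero h
  | cons hX _ s ih => exact append (h _ hX) ih s

/-- A nonzero direct sum has a nonzero summand. -/
lemma exists_retract {X : D} (hX : SumOf P X) (h0 : ¬ IsZero X) :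
    ∃ W, P W ∧ ¬ IsZero W ∧ Nonempty (Retract W X) := by
  induction hX with
  | zero h => exact absurd h h0
  | @cons Z X Y hX _ s ih =>
    by_cases hX0 : IsZero X
    · have hY0 : ¬ IsZero Y := fun hY0 => h0 ((IsZero.iff_id_eq_zero _).2 (by
        rw [← s.total, hX0.eq_of_src s.inl 0, hY0.eq_of_src s.inr 0]; simp))
      obtain ⟨W, hW, hW0, ⟨r⟩⟩ := ih hY0
      exact ⟨W, hW, hW0, ⟨r.trans s.retractSnd⟩⟩
    · exact ⟨X, hX, hX0, ⟨s.retractFst⟩⟩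

end SumOf

/-- In an additive category with finite dimensional morphism spaces every object is a finite
direct sum of indecomposable objects. -/
lemma sumOf_isIndec [HasFiniteBiproducts D] (k : Type w) [Field k] [Linear k D]
    (hk : ∀ X Y : D, Module.Finite k (X ⟶ Y)) (X : D) : SumOf (fun Z => IsIndec Z) X := by
  have : HasBinaryBiproducts D := hasBinaryBiproducts_of_finite_biproducts D
  have : HasZeroObject D := hasZeroObject_of_hasFiniteBiproducts D
  induction hn : Module.finrank k (X ⟶ X) using Nat.strong_induction_on generalizing X with
  | _ n ih =>
    by_cases h0 : IsZero X
    · exact .zero h0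
    by_cases h1 : IsIndec X
    · exact .of_mem h1
    have h2 : ∃ Y Z : D, ∃ _ : X ≅ Y ⊞ Z, ¬ IsZero Y ∧ ¬ IsZero Z := by
      by_contra hcon
      push Not at hcon
      refine h1 ⟨h0, fun Y Z e => ?_⟩
      by_cases hY : IsZero Y
      · exact Or.inl hY
      · exact Or.inr (hcon Y Z e hY)
    obtain ⟨Y, Z, e, hY, hZ⟩ := h2
    let s : Splitting X Y Z := (Splitting.ofBiprod Y Z).ofIso e
    have hYlt := finrank_end_lt k hk s.retractFst (fun f hf => hZ ((IsZero.iff_id_eq_zero Z).2 (by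
      have h := congrArg (fun t => s.inr ≫ t ≫ s.snd) hf
      simpa [Splitting.retractFst] using h.symm)))
    have hZlt := finrank_end_lt k hk s.retractSnd (fun f hf => hY ((IsZero.iff_id_eq_zero Y).2 (by
      have h := congrArg (fun t => s.inl ≫ t ≫ s.fst) hf
      simpa [Splitting.retractSnd] using h.symm)))
    exact SumOf.append (ih _ (hn ▸ hYlt) Y rfl) (ih _ (hn ▸ hZlt) Z rfl) s

/-- An object with local endomorphism ring. -/
def IsLocalObj (X : D) : Prop :=
  ¬ IsZero X ∧ ∀ f g : X ⟶ X, IsIso (f + g) → IsIso f ∨ IsIso g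

namespace IsLocalObj

variable {X : D}

lemma not_isIso_zero (hX : IsLocalObj X) : ¬ IsIso (0 : X ⟶ X) := fun h =>
  hX.1 ((IsZero.iff_id_eq_zero X).2 (by rw [← IsIso.hom_inv_id (0 : X ⟶ X), zero_comp]))

lemma isIso_or (hX : IsLocalObj X) (f : X ⟶ X) : IsIso f ∨ IsIso (𝟙 X - f) :=
  hX.2 _ _ (by rw [add_sub_cancel]; infer_instance)

lemma exists_of_sum (hX : IsLocalObj X) {ι : Type*} (s : Finset ι) (f : ι → (X ⟶ X))
    (h : IsIso (∑ a ∈ s, f a)) : ∃ a ∈ s, IsIso (f a) := by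
  classical
  induction s using Finset.induction_on with
  | empty => exact absurd h hX.not_isIso_zero
  | insert a s ha ih =>
    rw [Finset.sum_insert ha] at h
    rcases hX.2 _ _ h with h | h
    · exact ⟨a, Finset.mem_insert_self _ _, h⟩
    · obtain ⟨b, hb, h⟩ := ih h
      exact ⟨b, Finset.mem_insert_of_mem hb, h⟩

/-- A local direct summand of a finite direct sum is a direct summand of one of its terms. -/
lemma exists_retract_of_addClosure [HasFiniteBiproducts D] (hX : IsLocalObj X)
    {P : ObjectProperty D} (h : addClosure P X) : ∃ W, P W ∧ Nonempty (Retract X W) := by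
  obtain ⟨n, f, hf, ⟨r⟩⟩ := h
  have h1 : ∑ a, (r.i ≫ biproduct.π f a) ≫ (biproduct.ι f a ≫ r.r) = 𝟙 X := by
    have h2 := congrArg (fun t => r.i ≫ t ≫ r.r) (biproduct.total (f := f))
    simpa only [Preadditive.comp_sum, Preadditive.sum_comp, Category.assoc, Category.id_comp,
      r.retract] using h2
  obtain ⟨a, -, ha⟩ := hX.exists_of_sum Finset.univ
    (fun a => (r.i ≫ biproduct.π f a) ≫ (biproduct.ι f a ≫ r.r)) (by rw [h1]; infer_instance)
  exact ⟨f a, hf a, ⟨⟨r.i ≫ biproduct.π f a, (biproduct.ι f a ≫ r.r) ≫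
    inv ((r.i ≫ biproduct.π f a) ≫ (biproduct.ι f a ≫ r.r)), by
      rw [← Category.assoc]; exact IsIso.hom_inv_id _⟩⟩⟩

/-- A nonzero retract of a local object is isomorphic to it. -/
lemma nonempty_iso_of_retract (hX : IsLocalObj X) {Z : D} (r : Retract Z X) (hZ : ¬ IsZero Z) :
    Nonempty (Z ≅ X) := by
  have idem : (r.r ≫ r.i) ≫ (r.r ≫ r.i) = r.r ≫ r.i := by simp
  rcases hX.isIso_or (r.r ≫ r.i) with h | h
  · refine ⟨⟨r.i, r.r, r.retract, ?_⟩⟩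
    rw [← cancel_epi (r.r ≫ r.i), idem, Category.comp_id]
  · refine absurd ((IsZero.iff_id_eq_zero Z).2 ?_) hZ
    have h1 : (𝟙 X - r.r ≫ r.i) ≫ (r.r ≫ r.i) = 0 := by
      rw [Preadditive.sub_comp, idem, Category.id_comp, sub_self]
    have h2 : r.r ≫ r.i = 0 := by rw [← cancel_epi (𝟙 X - r.r ≫ r.i), h1, comp_zero]
    have h3 := congrArg (fun t => r.i ≫ t ≫ r.r) h2
    simpa using h3

lemma isIndec [HasFiniteBiproducts D] (hX : IsLocalObj X) : IsIndec X := by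
  have : HasBinaryBiproducts D := hasBinaryBiproducts_of_finite_biproducts D
  refine ⟨hX.1, fun Y Z e => ?_⟩
  by_contra hcon
  push Not at hcon
  let s : Splitting X Y Z := (Splitting.ofBiprod Y Z).ofIso e
  obtain ⟨e⟩ := hX.nonempty_iso_of_retract s.retractFst hcon.1
  rcases hX.2 (s.fst ≫ s.inl) (s.snd ≫ s.inr) (by rw [s.total]; infer_instance) with h | h
  · refine hcon.2 ((IsZero.iff_id_eq_zero Z).2 ?_)
    have h1 : s.inr = 0 := by rw [← cancel_mono (s.fst ≫ s.inl)]; simp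
    rw [← s.inr_snd, h1, zero_comp]
  · refine hcon.1 ((IsZero.iff_id_eq_zero Y).2 ?_)
    have h1 : s.inl = 0 := by rw [← cancel_mono (s.snd ≫ s.inr)]; simp
    rw [← s.inl_fst, h1, zero_comp]

/-- A full additive functor reflects isomorphisms among the endomorphisms of a local object that it
does not kill: modulo the kernel of the functor, an inverse lifts, and the kernel consists of
nonunits of a local ring. -/
lemma isIso_of_map (hX : IsLocalObj X) {E : Type u'} [Category.{v'} E] [Preadditive E] (F : D ⥤ E)
    [F.Additive] [F.Full] (h0 : ¬ IsZero (F.obj X)) (f : X ⟶ X) [IsIso (F.map f)] : IsIso f := by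
  obtain ⟨g, hg⟩ := F.map_surjective (inv (F.map f))
  have key : ∀ t : X ⟶ X, F.map t = 𝟙 _ → IsIso t := fun t ht => by
    rcases hX.isIso_or t with h | h
    · exact h
    · have h1 : F.map (𝟙 X - t) = 0 := by rw [F.map_sub, ht, F.map_id, sub_self]
      refine absurd ((IsZero.iff_id_eq_zero _).2 ?_) h0
      rw [← cancel_epi (F.map (𝟙 X - t)), h1, zero_comp, zero_comp]
  have h1 : IsIso (f ≫ g) := key _ (by rw [F.map_comp, hg, IsIso.hom_inv_id])
  have h2 : IsIso (g ≫ f) := key _ (by rw [F.map_comp, hg, IsIso.inv_hom_id])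
  have : IsSplitMono f := ⟨⟨⟨g ≫ inv (f ≫ g), by rw [← Category.assoc, IsIso.hom_inv_id]⟩⟩⟩
  have : Epi f := epi_of_epi g f
  exact isIso_of_epi_of_isSplitMono f

/-- A full additive functor takes local objects to local or zero objects. -/
lemma map (hX : IsLocalObj X) {E : Type u'} [Category.{v'} E] [Preadditive E] (F : D ⥤ E)
    [F.Additive] [F.Full] (h0 : ¬ IsZero (F.obj X)) : IsLocalObj (F.obj X) := by
  refine ⟨h0, fun f g h => ?_⟩
  obtain ⟨f, rfl⟩ := F.map_surjective f
  obtain ⟨g, rfl⟩ := F.map_surjective g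
  rw [← F.map_add] at h
  rcases hX.2 f g (hX.isIso_of_map F h0 (f + g)) with hf | hg
  · exact Or.inl inferInstance
  · exact Or.inr inferInstance

end IsLocalObj

/-- The endomorphism `e` is the projection onto a retract. -/
def Splits {Z : D} (e : Z ⟶ Z) : Prop :=
  ∃ (W : D) (i : W ⟶ Z) (r : Z ⟶ W), i ≫ r = 𝟙 W ∧ r ≫ i = e

/-- A sum of two orthogonal split idempotents is split. -/
lemma Splits.add [HasBinaryBiproducts D] {Z : D} {d e : Z ⟶ Z} (hd : Splits d) (he : Splits e)
    (hde : d ≫ e = 0) (hed : e ≫ d = 0) : Splits (d + e) := by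
  obtain ⟨W, i, r, hir, rfl⟩ := hd
  obtain ⟨V, j, q, hjq, rfl⟩ := he
  have h1 : i ≫ q = 0 := by
    have h := congrArg (fun t => i ≫ t ≫ q) hde
    simpa only [Category.assoc, reassoc_of% hir, hjq, Category.comp_id, zero_comp, comp_zero]
      using h
  have h2 : j ≫ r = 0 := by
    have h := congrArg (fun t => j ≫ t ≫ r) hed
    simpa only [Category.assoc, reassoc_of% hjq, hir, Category.comp_id, zero_comp, comp_zero]
      using h
  refine ⟨W ⊞ V, biprod.desc i j, biprod.lift r q, ?_, biprod.lift_desc⟩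
  ext <;> simp [hir, hjq, h1, h2]

omit [Preadditive D] in
/-- An idempotent living on a retract `Y` of `Z` splits if all idempotents of `Y` do. -/
lemma Splits.of_retract {Z Y : D} (hY : ∀ e : Y ⟶ Y, e ≫ e = e → Splits e) (r : Retract Y Z)
    {g : Z ⟶ Z} (hg : g ≫ g = g) (hl : r.r ≫ r.i ≫ g = g) (hr : g ≫ r.r ≫ r.i = g) :
    Splits g := by
  have hr' : g ≫ r.r ≫ r.i ≫ g = g := by
    have h := congrArg (fun t => t ≫ g) hr
    simpa only [Category.assoc, hg] using h
  obtain ⟨W, j, q, hjq, hqj⟩ := hY (r.i ≫ g ≫ r.r) (by simp only [Category.assoc, reassoc_of% hr'])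
  refine ⟨W, j ≫ r.i, r.r ≫ q, by simp [hjq], ?_⟩
  calc (r.r ≫ q) ≫ j ≫ r.i = r.r ≫ (q ≫ j) ≫ r.i := by simp only [Category.assoc]
    _ = (r.r ≫ r.i ≫ g) ≫ r.r ≫ r.i := by rw [hqj]; simp only [Category.assoc]
    _ = g := by rw [hl, hr]

/-- An idempotent with invertible diagonal entry at the summand `X` of `Z` dominates an idempotent
with image `X`, whose complement is isomorphic to the other summand of `Z`. -/
lemma Splitting.exists_exchange {Z X Y : D} (s : Splitting Z X Y) (d : Z ⟶ Z) (hd : d ≫ d = d)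
    [IsIso (s.inl ≫ d ≫ s.fst)] :
    ∃ (p : Retract X Z) (q : Retract Y Z), p.i ≫ d = p.i ∧ d ≫ p.r = p.r ∧
      q.r ≫ q.i = 𝟙 Z - p.r ≫ p.i := by
  let i := s.inl ≫ d
  let r := d ≫ s.fst ≫ inv (s.inl ≫ d ≫ s.fst)
  have hlr : s.inl ≫ r = 𝟙 X := by
    have := IsIso.hom_inv_id (s.inl ≫ d ≫ s.fst)
    simpa only [r, Category.assoc] using this
  have hdr : d ≫ r = r := by simp only [r]; rw [reassoc_of% hd]
  have hir : i ≫ r = 𝟙 X := by rw [Category.assoc, hdr, hlr]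
  have hyy : s.snd ≫ s.inr = 𝟙 Z - s.fst ≫ s.inl := by rw [← s.total]; abel
  refine ⟨⟨i, r, hir⟩, ⟨s.inr ≫ (𝟙 Z - r ≫ s.inl), (𝟙 Z - r ≫ i) ≫ s.snd, ?_⟩, ?_, hdr, ?_⟩
  · have h1 : (𝟙 Z - r ≫ s.inl) ≫ (𝟙 Z - r ≫ i) = 𝟙 Z - r ≫ s.inl := by
      simp [Preadditive.comp_sub, Preadditive.sub_comp, reassoc_of% hlr]
    calc (s.inr ≫ (𝟙 Z - r ≫ s.inl)) ≫ (𝟙 Z - r ≫ i) ≫ s.snd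
        = s.inr ≫ ((𝟙 Z - r ≫ s.inl) ≫ (𝟙 Z - r ≫ i)) ≫ s.snd := by simp only [Category.assoc]
      _ = 𝟙 Y := by rw [h1]; simp [Preadditive.sub_comp]
  · simp only [i, Category.assoc, hd]
  · calc ((𝟙 Z - r ≫ i) ≫ s.snd) ≫ s.inr ≫ (𝟙 Z - r ≫ s.inl)
        = (𝟙 Z - r ≫ i) ≫ (s.snd ≫ s.inr) ≫ (𝟙 Z - r ≫ s.inl) := by simp only [Category.assoc]
      _ = 𝟙 Z - r ≫ i := by
        rw [hyy]
        simp [Preadditive.comp_sub, Preadditive.sub_comp, reassoc_of% hlr, reassoc_of% hir]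

/-- Idempotent endomorphisms of finite direct sums of local objects split. For the first summand
`X`, one of the diagonal entries of `e` and `1 - e` at `X` is invertible; accordingly `X` splits off
the image or the kernel of `e`, and the complement is isomorphic to the remaining direct sum. -/
lemma SumOf.splits {P : ObjectProperty D} [HasBinaryBiproducts D]
    (hP : ∀ X, P X → IsLocalObj X) {Z : D} (hZ : SumOf P Z) (e : Z ⟶ Z) (he : e ≫ e = e) :
    Splits e := by
  induction hZ with
  | @zero Z h => exact ⟨Z, 𝟙 Z, 𝟙 Z, by simp, h.eq_of_src _ _⟩
  | @cons Z X Y hX _ s ih =>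
    rcases (hP X hX).2 (s.inl ≫ e ≫ s.fst) (s.inl ≫ (𝟙 Z - e) ≫ s.fst)
      (by
        rw [← Preadditive.comp_add, ← Preadditive.add_comp, add_sub_cancel, Category.id_comp,
          s.inl_fst]
        infer_instance) with h | h
    · obtain ⟨p, q, hpe, hep, hq⟩ := s.exists_exchange e he
      have h1 : (e - p.r ≫ p.i) ≫ p.r ≫ p.i = 0 := by
        rw [Preadditive.sub_comp, reassoc_of% hep, Category.assoc, p.retract_assoc, sub_self]
      have h2 : p.r ≫ p.i ≫ (e - p.r ≫ p.i) = 0 := by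
        rw [Preadditive.comp_sub, hpe, p.retract_assoc, sub_self, comp_zero]
      have h3 : (e - p.r ≫ p.i) ≫ (e - p.r ≫ p.i) = e - p.r ≫ p.i := by
        rw [Preadditive.comp_sub, h1, Preadditive.sub_comp, he, Category.assoc, hpe, sub_zero]
      have h4 : Splits (e - p.r ≫ p.i) := Splits.of_retract ih q h3
        (by rw [← Category.assoc, hq, Preadditive.sub_comp, Category.assoc, h2, sub_zero,
          Category.id_comp])
        (by rw [hq, Preadditive.comp_sub, h1, sub_zero, Category.comp_id])
      have h5 := Splits.add ⟨X, p.i, p.r, p.retract, rfl⟩ h4 (by rw [Category.assoc, h2]) h1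
      rwa [add_sub_cancel] at h5
    · obtain ⟨p, q, hpe, hep, hq⟩ := s.exists_exchange (𝟙 Z - e)
        (by simp [Preadditive.comp_sub, Preadditive.sub_comp, he])
      have hpe' : p.i ≫ e = 0 := by simpa [Preadditive.comp_sub] using hpe
      have hep' : e ≫ p.r = 0 := by simpa [Preadditive.sub_comp] using hep
      refine Splits.of_retract ih q he ?_ ?_
      · rw [← Category.assoc, hq, Preadditive.sub_comp, Category.assoc, hpe', comp_zero, sub_zero,
          Category.id_comp]
      · rw [hq, Preadditive.comp_sub, reassoc_of% hep', zero_comp, sub_zero, Category.comp_id]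

end KrullSchmidt

/-! ### Residue fields of local endomorphism algebras -/

section Residue

variable {k : Type w} [Field k] {R : Type v} [Ring R] [Algebra k R]

/-- Fitting's lemma for an algebraic element: writing its minimal polynomial as `X ^ n * q` with `q`
prime to `X` gives an idempotent, so without nontrivial idempotents the element is invertible or
nilpotent. -/
lemma isUnit_or_isNilpotent_of_idempotents (h : ∀ e : R, e * e = e → e = 0 ∨ e = 1) {a : R}
    (ha : IsIntegral k a) : IsUnit a ∨ IsNilpotent a := by
  obtain ⟨q, hq, hX⟩ := (minpoly k a).exists_eq_pow_rootMultiplicity_mul_and_not_dvd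
    (minpoly.ne_zero ha) 0
  rw [map_zero, sub_zero] at hq hX
  set n := (minpoly k a).rootMultiplicity 0
  have hc : IsCoprime ((Polynomial.X : Polynomial k) ^ n) q :=
    ((Polynomial.irreducible_X.coprime_iff_not_dvd).2 hX).pow_left
  obtain ⟨s, t, hst⟩ := hc
  have h0 : Polynomial.aeval a (Polynomial.X ^ n * q) = 0 := by rw [← hq]; exact minpoly.aeval k a
  have h1 : Polynomial.aeval a (s * Polynomial.X ^ n) + Polynomial.aeval a (t * q) = 1 := by
    rw [← map_add, hst, map_one]
  have h2 : Polynomial.aeval a (s * Polynomial.X ^ n) * Polynomial.aeval a (t * q) = 0 := by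
    rw [← map_mul, show s * Polynomial.X ^ n * (t * q) = s * t * (Polynomial.X ^ n * q) by ring,
      map_mul, h0, mul_zero]
  have h3 : a ^ n * Polynomial.aeval a (t * q) = 0 := by
    have h4 : a ^ n * Polynomial.aeval a (t * q) =
        Polynomial.aeval a (t * (Polynomial.X ^ n * q)) := by
      rw [show t * (Polynomial.X ^ n * q) = Polynomial.X ^ n * (t * q) by ring, map_mul]
      simp
    rw [h4, map_mul, h0, mul_zero]
  rcases h (Polynomial.aeval a (s * Polynomial.X ^ n)) (by
      conv_rhs => rw [← mul_one (Polynomial.aeval a (s * Polynomial.X ^ n)), ← h1]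
      rw [mul_add, h2, add_zero]) with he | he
  · refine Or.inr ⟨n, ?_⟩
    rw [he, zero_add] at h1
    rwa [h1, mul_one] at h3
  · by_cases hn : n = 0
    · -- here `a` is a root of `q`, a polynomial with nonzero constant term
      have hq0 : Polynomial.aeval a q = 0 := by simpa [hn] using h0
      obtain ⟨s', t', hst'⟩ := (Polynomial.irreducible_X.coprime_iff_not_dvd).2 hX
      have h4 : Polynomial.aeval a s' * a = 1 := by
        have h5 := congrArg (Polynomial.aeval a) hst'
        simpa [hq0] using h5
      have h5 : a * Polynomial.aeval a s' = 1 := by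
        have h6 := congrArg (Polynomial.aeval a) ((mul_comm Polynomial.X s').trans
          (eq_sub_of_add_eq hst'))
        simpa [hq0] using h6
      exact Or.inl ⟨⟨a, _, h5, h4⟩, rfl⟩
    · refine Or.inl ((isUnit_pow_iff hn).1 ⟨⟨a ^ n, Polynomial.aeval a s, ?_, ?_⟩, rfl⟩)
      · have h4 : a ^ n * Polynomial.aeval a s =
            Polynomial.aeval a (s * Polynomial.X ^ n) := by
          rw [mul_comm s, map_mul]; simp
        rw [h4, he]
      · rw [← he, map_mul]; simp

/-- A finite dimensional algebra over an algebraically closed field without nontrivial idempotents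
is local with residue field `k`, and the kernel of the residue map is a nilpotent ideal. -/
lemma exists_residue_of_idempotents [IsAlgClosed k] [Module.Finite k R] [Nontrivial R]
    (h : ∀ e : R, e * e = e → e = 0 ∨ e = 1) :
    ∃ χ : R →ₐ[k] k, (∀ a, IsUnit a ↔ χ a ≠ 0) ∧ ∃ m, RingHom.ker χ ^ m = ⊥ := by
  have : IsArtinianRing R := IsArtinianRing.of_finite k R
  have hun : ∀ a : R, IsUnit a ∨ IsNilpotent a := fun a =>
    isUnit_or_isNilpotent_of_idempotents h (Algebra.IsIntegral.isIntegral (R := k) a)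
  have hloc : IsLocalRing R := .of_isUnit_or_isUnit_one_sub_self fun a =>
    (hun a).imp id fun ha => ha.isUnit_one_sub
  have hl : ∀ {a b : R}, b ∈ nonunits R → a * b ∈ nonunits R :=
    fun hb h => hb (isUnit_of_mul_isUnit_right h)
  have hr : ∀ {a b : R}, a ∈ nonunits R → a * b ∈ nonunits R :=
    fun ha h => ha (isUnit_of_mul_isUnit_left h)
  have hex : ∀ a : R, ∃ c : k, a - algebraMap k R c ∈ nonunits R := fun a => by
    obtain ⟨c, hc⟩ := spectrum.nonempty_of_isAlgClosed_of_finiteDimensional k a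
    rw [spectrum.mem_iff, IsUnit.sub_iff] at hc
    exact ⟨c, hc⟩
  choose χ hχ using hex
  have huniq : ∀ (a : R) (c : k), a - algebraMap k R c ∈ nonunits R → χ a = c := by
    intro a c hc
    by_contra hne
    have h1 := IsLocalRing.nonunits_add hc (hl (a := -1) (hχ a))
    rw [neg_one_mul, neg_sub, sub_add_sub_cancel', ← map_sub] at h1
    exact h1 ((IsUnit.mk0 _ (sub_ne_zero.2 hne)).map (algebraMap k R))
  have h0 : (0 : R) ∈ nonunits R := not_isUnit_zero
  let χ' : R →ₐ[k] k :=
    { toFun := χ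
      map_one' := huniq _ _ (by rw [map_one, sub_self]; exact h0)
      map_zero' := huniq _ _ (by rw [map_zero, sub_self]; exact h0)
      map_add' := fun a b => huniq _ _ (by
        rw [map_add, add_sub_add_comm]; exact IsLocalRing.nonunits_add (hχ a) (hχ b))
      map_mul' := fun a b => huniq _ _ (by
        rw [map_mul, show a * b - algebraMap k R (χ a) * algebraMap k R (χ b) =
          a * (b - algebraMap k R (χ b)) + (a - algebraMap k R (χ a)) * algebraMap k R (χ b) by
            noncomm_ring]
        exact IsLocalRing.nonunits_add (hl (hχ b)) (hr (hχ a)))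
      commutes' := fun c => huniq _ _ (by rw [Algebra.algebraMap_self_apply, sub_self]; exact h0) }
  have hiff : ∀ a, IsUnit a ↔ χ' a ≠ 0 := fun a => by
    refine ⟨fun ha => (ha.map χ').ne_zero, fun ha => ?_⟩
    by_contra hna
    exact ha (huniq a 0 (by rwa [map_zero, sub_zero]))
  refine ⟨χ', hiff, ?_⟩
  obtain ⟨m, hm⟩ := IsArtinianRing.isNilpotent_jacobson_bot (R := R)
  refine ⟨m, le_bot_iff.1 (le_trans (Ideal.pow_right_mono (fun a ha => ?_) m) hm.le)⟩
  refine Ideal.mem_jacobson_iff.2 fun y => ?_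
  have h1 : IsUnit (y * a + 1) := (hiff _).2 (by
    rw [map_add, map_mul, show χ' a = 0 from ha, mul_zero, zero_add, map_one]; exact one_ne_zero)
  obtain ⟨c, hc⟩ := h1
  refine ⟨↑c⁻¹, ?_⟩
  rw [Ideal.mem_bot, mul_assoc, ← mul_add_one, ← hc, Units.inv_mul, sub_self]

end Residue

section Indecomposable

variable {k : Type w} [Field k] {D : Type u} [Category.{v} D] [Preadditive D] [Linear k D]

/-- An indecomposable object of an idempotent complete category has only trivial idempotents. -/
lemma IsIndec.eq_zero_or_eq_id [HasFiniteBiproducts D] [IsIdempotentComplete D] {X : D}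
    (hX : IsIndec X) (e : X ⟶ X) (he : e ≫ e = e) : e = 0 ∨ e = 𝟙 X := by
  have : HasBinaryBiproducts D := hasBinaryBiproducts_of_finite_biproducts D
  obtain ⟨Y, i, r, hir, hri⟩ := IsIdempotentComplete.idempotents_split X e he
  obtain ⟨Z, j, q, hjq, hqj⟩ := IsIdempotentComplete.idempotents_split X (𝟙 X - e)
    (Idempotents.idem_of_id_sub_idem e he)
  have hiq : i ≫ q = 0 := by
    have h : i ≫ (𝟙 X - e) ≫ q = 0 := by
      rw [Preadditive.sub_comp, Preadditive.comp_sub, ← hri, Category.id_comp, Category.assoc,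
        reassoc_of% hir, sub_self]
    rw [← hqj] at h
    simpa [hjq] using h
  have hjr : j ≫ r = 0 := by
    have h : j ≫ e ≫ r = 0 := by
      have h1 : e = 𝟙 X - q ≫ j := by rw [hqj, sub_sub_cancel]
      rw [h1, Preadditive.sub_comp, Preadditive.comp_sub, Category.id_comp, Category.assoc,
        reassoc_of% hjq, sub_self]
    rw [← hri] at h
    simpa [hir] using h
  rcases hX.2 Y Z ⟨biprod.lift r q, biprod.desc i j, by rw [biprod.lift_desc, hri, hqj,
      add_sub_cancel], by ext <;> simp [hir, hjq, hiq, hjr]⟩ with h | h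
  · exact Or.inl (by rw [← hri, h.eq_of_src i 0, comp_zero])
  · refine Or.inr ?_
    rw [h.eq_of_src j 0, comp_zero] at hqj
    exact (sub_eq_zero.1 hqj.symm).symm

variable (k) in
/-- The endomorphism algebra of an indecomposable object is local with residue field `k`. The
residue map is a homomorphism `χ` to `k` that detects isomorphisms; its kernel is nilpotent. -/
lemma IsIndec.exists_residue [IsAlgClosed k] [hD : IsFinitaryCategory k D] [HasFiniteBiproducts D]
    {X : D} (hX : IsIndec X) :
    ∃ χ : End X →ₐ[k] k, (∀ a : End X, IsIso a ↔ χ a ≠ 0) ∧ ∃ m, RingHom.ker χ ^ m = ⊥ := by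
  have := hD.isIdempotentComplete
  have : Module.Finite k (End X) := hD.finiteDimensional X X
  have : Nontrivial (End X) := ⟨0, 1, fun h => hX.1 ((IsZero.iff_id_eq_zero X).2 h.symm)⟩
  obtain ⟨χ, h1, h2⟩ := exists_residue_of_idempotents (k := k) (R := End X)
    fun e he => hX.eq_zero_or_eq_id e he
  exact ⟨χ, fun a => (isUnit_iff_isIso a).symm.trans (h1 a), h2⟩

variable (k) in
lemma IsIndec.isLocalObj [IsAlgClosed k] [hD : IsFinitaryCategory k D] [HasFiniteBiproducts D]
    {X : D} (hX : IsIndec X) : IsLocalObj X := by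
  obtain ⟨χ, h, -⟩ := hX.exists_residue k
  refine ⟨hX.1, fun f g hfg => ?_⟩
  by_contra hcon
  push Not at hcon
  have hf : χ f = 0 := not_not.1 fun hf => hcon.1 ((h f).2 hf)
  have hg : χ g = 0 := not_not.1 fun hg => hcon.2 ((h g).2 hg)
  refine (h (f + g : X ⟶ X)).1 hfg ?_
  have := map_add χ f g
  rw [hf, hg, add_zero] at this
  exact this

end Indecomposable

/-! ### Evaluation of morphisms in a tensor product of linear categories -/

namespace PureTensor

variable {k : Type w} [Field k] {D : Type u} [Category.{v} D] [Preadditive D] [Linear k D]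
  {E : Type u'} [Category.{v'} E] [Preadditive E] [Linear k E]

variable (k D) in
/-- The functor `X ↦ X ⊠ Y`. -/
@[reducible] def left (Y : E) : D ⥤ PureTensor k D E where
  obj X := ⟨X, Y⟩
  map {X X'} f := show (⟨X, Y⟩ : PureTensor k D E) ⟶ ⟨X', Y⟩ from f ⊗ₜ[k] 𝟙 Y
  map_comp f g := by
    refine Eq.trans ?_ (comp_tmul (X := ⟨_, Y⟩) (Y := ⟨_, Y⟩) (Z := ⟨_, Y⟩) f (𝟙 Y) g (𝟙 Y)).symm
    rw [Category.comp_id]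

instance (Y : E) : (left k D Y).Additive where
  map_add {_ _ f g} := TensorProduct.add_tmul f g (𝟙 Y)

instance (Y : E) : (left k D Y).Linear k where
  map_smul f c := (TensorProduct.smul_tmul' c f (𝟙 Y)).symm

variable (k E) in
/-- The functor `Y ↦ X ⊠ Y`. -/
@[reducible] def right (X : D) : E ⥤ PureTensor k D E where
  obj Y := ⟨X, Y⟩
  map {Y Y'} g := show (⟨X, Y⟩ : PureTensor k D E) ⟶ ⟨X, Y'⟩ from 𝟙 X ⊗ₜ[k] g
  map_comp f g := by
    refine Eq.trans ?_ (comp_tmul (X := ⟨X, _⟩) (Y := ⟨X, _⟩) (Z := ⟨X, _⟩) (𝟙 X) f (𝟙 X) g).symm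
    rw [Category.comp_id]

instance (X : D) : (right k E X).Additive where
  map_add {_ _ f g} := TensorProduct.tmul_add (𝟙 X) f g

/-- The linear map `f ⊗ g ↦ φ g • f`. -/
def eval {X₁ X₂ : D} {Y₁ Y₂ : E} (φ : (Y₁ ⟶ Y₂) →ₗ[k] k) :
    ((⟨X₁, Y₁⟩ : PureTensor k D E) ⟶ ⟨X₂, Y₂⟩) →ₗ[k] (X₁ ⟶ X₂) :=
  (TensorProduct.rid k (X₁ ⟶ X₂)).toLinearMap ∘ₗ LinearMap.lTensor (X₁ ⟶ X₂) φ

lemma eval_tmul {X₁ X₂ : D} {Y₁ Y₂ : E} (φ : (Y₁ ⟶ Y₂) →ₗ[k] k) (f : X₁ ⟶ X₂) (g : Y₁ ⟶ Y₂) :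
    eval φ (show (⟨X₁, Y₁⟩ : PureTensor k D E) ⟶ ⟨X₂, Y₂⟩ from f ⊗ₜ[k] g) = φ g • f := by
  exact TensorProduct.rid_tmul f (φ g)

lemma eval_map {D₁ : Type u} [Category.{v} D₁] [Preadditive D₁] [Linear k D₁]
    {D₂ : Type u} [Category.{v} D₂] [Preadditive D₂] [Linear k D₂] (F : D₁ ⥤ D₂) [F.Additive]
    [F.Linear k] {X₁ X₂ : D₁} {Y₁ Y₂ : E} (φ : (Y₁ ⟶ Y₂) →ₗ[k] k)
    (u : (⟨X₁, Y₁⟩ : PureTensor k D₁ E) ⟶ ⟨X₂, Y₂⟩) :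
    eval φ (show (⟨F.obj X₁, Y₁⟩ : PureTensor k D₂ E) ⟶ ⟨F.obj X₂, Y₂⟩ from (map F).map u) =
      F.map (eval φ u) := by
  induction u using hom_induction with
  | zero => rw [(eval φ).map_zero, F.map_zero, (map F).map_zero]; exact (eval φ).map_zero
  | add a b ha hb =>
    rw [(eval φ).map_add, F.map_add, ← ha, ← hb, (map F).map_add]
    exact (eval φ).map_add _ _
  | tmul f g =>
    rw [eval_tmul, F.map_smul]
    exact eval_tmul φ (F.map f) g

/-- The residue map of an object, as a linear functional on endomorphisms. -/
abbrev resFun {Y : E} (χ : End Y →ₐ[k] k) : (Y ⟶ Y) →ₗ[k] k := χ.toLinearMap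

lemma eval_resFun_comp {X₁ X₂ X₃ : D} {Y : E} (χ : End Y →ₐ[k] k)
    (u : (⟨X₁, Y⟩ : PureTensor k D E) ⟶ ⟨X₂, Y⟩) (u' : (⟨X₂, Y⟩ : PureTensor k D E) ⟶ ⟨X₃, Y⟩) :
    eval (resFun χ) (u ≫ u') = eval (resFun χ) u ≫ eval (resFun χ) u' := by
  induction u using hom_induction with
  | zero => rw [zero_comp, (eval (resFun χ)).map_zero, (eval (resFun χ)).map_zero, zero_comp]
  | add a b ha hb =>
    rw [Preadditive.add_comp, (eval (resFun χ)).map_add, ha, hb, (eval (resFun χ)).map_add,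
      Preadditive.add_comp]
  | tmul f g =>
    induction u' using hom_induction with
    | zero => rw [comp_zero, (eval (resFun χ)).map_zero, (eval (resFun χ)).map_zero, comp_zero]
    | add a b ha hb =>
      rw [Preadditive.comp_add, (eval (resFun χ)).map_add, ha, hb, (eval (resFun χ)).map_add,
        Preadditive.comp_add]
    | tmul f' g' =>
      rw [eval_tmul, eval_tmul, Linear.smul_comp, Linear.comp_smul, smul_smul]
      refine (eval_tmul (resFun χ) (f ≫ f') (g ≫ g')).trans ?_
      congr 1
      exact (map_mul χ (show End Y from g') (show End Y from g)).trans (mul_comm _ _)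

lemma eval_left_map {X₁ X₂ : D} {Y : E} (χ : End Y →ₐ[k] k) (f : X₁ ⟶ X₂) :
    eval (resFun χ) ((left k D Y).map f) = f := by
  refine (eval_tmul (resFun χ) f (𝟙 Y)).trans ?_
  rw [show resFun χ (𝟙 Y) = 1 from map_one χ, one_smul]

/-- The span of the endomorphisms `f ⊗ g` of `X ⊠ Y` with `g` in the `n`-th power of the kernel of
the residue map of `Y`. -/
def radPow (X : D) {Y : E} (χ : End Y →ₐ[k] k) (n : ℕ) :
    Submodule k ((⟨X, Y⟩ : PureTensor k D E) ⟶ ⟨X, Y⟩) :=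
  Submodule.span k {u | ∃ (f : X ⟶ X) (g : End Y), g ∈ RingHom.ker χ ^ n ∧ u = f ⊗ₜ[k] (g : Y ⟶ Y)}

lemma mem_radPow_one {X : D} {Y : E} {χ : End Y →ₐ[k] k}
    {u : (⟨X, Y⟩ : PureTensor k D E) ⟶ ⟨X, Y⟩} (hu : eval (resFun χ) u = 0) :
    u ∈ radPow X χ 1 := by
  suffices h : u - (show (⟨X, Y⟩ : PureTensor k D E) ⟶ ⟨X, Y⟩ from
      (left k D Y).map (eval (resFun χ) u)) ∈ radPow X χ 1 by
    rwa [hu, Functor.map_zero, sub_zero] at h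
  clear hu
  induction u using hom_induction with
  | zero => rw [(eval (resFun χ)).map_zero, Functor.map_zero, sub_zero]; exact zero_mem _
  | add a b ha hb =>
    rw [(eval (resFun χ)).map_add, Functor.map_add, add_sub_add_comm]
    exact add_mem ha hb
  | tmul f g =>
    refine Submodule.subset_span ⟨f, (g - χ g • 𝟙 Y : Y ⟶ Y), ?_, ?_⟩
    · rw [Submodule.pow_one]
      refine (map_sub χ (show End Y from g) (χ g • (1 : End Y))).trans ?_
      rw [map_smul, map_one, smul_eq_mul, mul_one, sub_self]
    · rw [eval_tmul, Functor.map_smul]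
      refine Eq.trans ?_ (TensorProduct.tmul_sub f g (χ g • 𝟙 Y)).symm
      rw [TensorProduct.tmul_smul]
      rfl

lemma comp_mem_radPow {X : D} {Y : E} {χ : End Y →ₐ[k] k} {n : ℕ}
    {z t : (⟨X, Y⟩ : PureTensor k D E) ⟶ ⟨X, Y⟩} (hz : z ∈ radPow X χ 1)
    (ht : t ∈ radPow X χ n) : z ≫ t ∈ radPow X χ (n + 1) := by
  induction hz using Submodule.span_induction with
  | zero => rw [zero_comp]; exact zero_mem _
  | add a b _ _ ha hb => rw [Preadditive.add_comp]; exact add_mem ha hb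
  | smul c a _ ha => rw [Linear.smul_comp]; exact Submodule.smul_mem _ c ha
  | mem a ha =>
    obtain ⟨f', g', hg', rfl⟩ := ha
    induction ht using Submodule.span_induction with
    | zero => rw [comp_zero]; exact zero_mem _
    | add a b _ _ ha hb => rw [Preadditive.comp_add]; exact add_mem ha hb
    | smul c a _ ha => rw [Linear.comp_smul]; exact Submodule.smul_mem _ c ha
    | mem a ha =>
      obtain ⟨f, g, hg, rfl⟩ := ha
      refine Submodule.subset_span ⟨f' ≫ f, g * g', ?_, rfl⟩
      rw [Submodule.pow_one] at hg'
      rw [Submodule.pow_succ]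
      exact Ideal.mul_mem_mul hg hg'

/-- If the kernel of the residue map of `Y` is nilpotent, then evaluation reflects isomorphisms
among endomorphisms of `X ⊠ Y`: its kernel consists of nilpotent elements. -/
lemma isIso_of_isIso_eval {X : D} {Y : E} {χ : End Y →ₐ[k] k} (hχ : ∃ m, RingHom.ker χ ^ m = ⊥)
    (u : (⟨X, Y⟩ : PureTensor k D E) ⟶ ⟨X, Y⟩) (hu : IsIso (eval (resFun χ) u)) : IsIso u := by
  obtain ⟨m, hm⟩ := hχ
  let t : (⟨X, Y⟩ : PureTensor k D E) ⟶ ⟨X, Y⟩ :=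
    u ≫ (left k D Y).map (inv (eval (resFun χ) u))
  have ht : eval (resFun χ) t = 𝟙 X := by
    refine (eval_resFun_comp χ u _).trans ?_
    rw [eval_left_map, IsIso.hom_inv_id]
  let z : End (⟨X, Y⟩ : PureTensor k D E) :=
    𝟙 (⟨X, Y⟩ : PureTensor k D E) - t
  have hz : z ∈ radPow X χ 1 := by
    refine mem_radPow_one ?_
    refine ((eval (resFun χ)).map_sub (𝟙 _) t).trans ?_
    rw [ht, ← (left k D Y).map_id X]
    exact sub_eq_zero.2 (eval_left_map χ (𝟙 X))
  have hpow : ∀ n : ℕ, z ^ (n + 1) ∈ radPow X χ (n + 1) := by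
    intro n
    induction n with
    | zero => rw [zero_add, pow_one]; exact hz
    | succ n ih => rw [pow_succ]; exact comp_mem_radPow hz ih
  have hbot : radPow X χ (m + 1) = ⊥ := by
    refine Submodule.span_eq_bot.2 ?_
    rintro _ ⟨f, g, hg, rfl⟩
    rw [Submodule.pow_succ, hm, Ideal.bot_mul] at hg
    rw [(Submodule.mem_bot _).1 hg]
    exact TensorProduct.tmul_zero _ f
  have hnil : IsNilpotent z := ⟨m + 1, by
    have h := hpow m
    rw [hbot] at h
    exact h⟩
  have h1 : IsUnit (show End (⟨X, Y⟩ : PureTensor k D E) from t) := by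
    have h2 := hnil.isUnit_one_sub
    rwa [show 1 - z = t from sub_sub_cancel (𝟙 (⟨X, Y⟩ : PureTensor k D E)) t] at h2
  have h2 : IsIso t := (isUnit_iff_isIso _).1 h1
  have h3 : IsIso ((left k D Y).map (inv (eval (resFun χ) u))) :=
    Functor.map_isIso (left k D Y) _
  exact @IsIso.of_isIso_comp_right _ _ _ _ _ u _ h3 h2

lemma isIso_eval {X : D} {Y : E} (χ : End Y →ₐ[k] k)
    (u : (⟨X, Y⟩ : PureTensor k D E) ⟶ ⟨X, Y⟩) [IsIso u] : IsIso (eval (resFun χ) u) := by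
  have h : eval (resFun χ) (𝟙 (⟨X, Y⟩ : PureTensor k D E)) = 𝟙 X := by
    rw [show 𝟙 (⟨X, Y⟩ : PureTensor k D E) = (left k D Y).map (𝟙 X) from
      ((left k D Y).map_id X).symm, eval_left_map]
  exact ⟨eval (resFun χ) (inv u), by rw [← eval_resFun_comp, IsIso.hom_inv_id, h],
    by rw [← eval_resFun_comp, IsIso.inv_hom_id, h]⟩

lemma isLocalObj_of_residue {X : D} (hX : IsLocalObj X) {Y : E} {χ : End Y →ₐ[k] k}
    (hχ : ∃ m, RingHom.ker χ ^ m = ⊥) : IsLocalObj (⟨X, Y⟩ : PureTensor k D E) := by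
  refine ⟨fun h => hX.1 ?_, fun f g h => ?_⟩
  · have h1 : (left k D Y).map (𝟙 X) = 0 := h.eq_of_src _ _
    refine (IsZero.iff_id_eq_zero X).2 ((eval_left_map χ (𝟙 X)).symm.trans ?_)
    rw [h1]
    exact (eval (resFun χ)).map_zero
  · have h1 := isIso_eval χ (f + g)
    rw [LinearMap.map_add] at h1
    exact (hX.2 _ _ h1).imp (isIso_of_isIso_eval hχ f) (isIso_of_isIso_eval hχ g)

/-- If no composite `Y' ⟶ Y ⟶ Y'` is invertible, then no nonzero `X' ⊠ Y'` is a retract of an object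
`X ⊠ Y`. -/
lemma exists_isIso_of_retract {X X' : D} {Y Y' : E} {χ : End Y' →ₐ[k] k}
    (hχ : ∀ a : End Y', IsIso a ↔ χ a ≠ 0) (hX' : ¬ IsZero X')
    (r : Retract (⟨X', Y'⟩ : PureTensor k D E) ⟨X, Y⟩) :
    ∃ (a : Y' ⟶ Y) (b : Y ⟶ Y'), IsIso (a ≫ b) := by
  by_contra hcon
  push Not at hcon
  have key : ∀ (p : (⟨X', Y'⟩ : PureTensor k D E) ⟶ ⟨X, Y⟩)
      (q : (⟨X, Y⟩ : PureTensor k D E) ⟶ ⟨X', Y'⟩),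
      eval (resFun χ) (p ≫ q) = 0 := by
    intro p q
    induction p using hom_induction with
    | zero => rw [zero_comp, LinearMap.map_zero]
    | add a b ha hb => rw [Preadditive.add_comp, LinearMap.map_add, ha, hb, add_zero]
    | tmul f g =>
      induction q using hom_induction with
      | zero => rw [comp_zero, LinearMap.map_zero]
      | add a b ha hb => rw [Preadditive.comp_add, LinearMap.map_add, ha, hb, add_zero]
      | tmul f' g' =>
        refine (eval_tmul (resFun χ) (f ≫ f') (g ≫ g')).trans ?_
        have h0 : χ (g ≫ g' : Y' ⟶ Y') = 0 := not_not.1 fun h => hcon g g' ((hχ _).2 h)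
        rw [show resFun χ (g ≫ g') = 0 from h0, zero_smul]
  refine hX' ((IsZero.iff_id_eq_zero X').2 ?_)
  have h1 := key r.i r.r
  rw [r.retract] at h1
  rwa [show 𝟙 (⟨X', Y'⟩ : PureTensor k D E) = (left k D Y').map (𝟙 X') from
    ((left k D Y').map_id X').symm, eval_left_map] at h1

end PureTensor

/-! ### Indecomposable objects of a tensor product of finitary categories -/

lemma isZero_of_isZero_map {D : Type u} [Category.{v} D] [Preadditive D] {E : Type u'}
    [Category.{v'} E] [Preadditive E] (F : D ⥤ E) [F.Faithful] [F.Additive] {X : D}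
    (h : IsZero (F.obj X)) : IsZero X :=
  (IsZero.iff_id_eq_zero X).2 (F.map_injective (h.eq_of_src _ _))

/-- An indecomposable finite direct sum of nonzero objects has exactly one summand. -/
lemma SumOf.exists_iso_of_isIndec {D : Type u} [Category.{v} D] [Preadditive D]
    [HasFiniteBiproducts D] {P : ObjectProperty D} (hP : ∀ X, P X → ¬ IsZero X) {Z : D}
    (hZ : IsIndec Z) (h : SumOf P Z) : ∃ X, P X ∧ Nonempty (Z ≅ X) := by
  have : HasBinaryBiproducts D := hasBinaryBiproducts_of_finite_biproducts D
  cases h with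
  | zero h => exact absurd h hZ.1
  | @cons _ X Y hX _ s =>
    have hY : IsZero Y := (hZ.2 X Y (s.iso (Splitting.ofBiprod X Y) (Iso.refl _)
      (Iso.refl _))).resolve_left (hP X hX)
    exact ⟨X, hX, ⟨s.iso (Splitting.nonempty_zero_right X hY).some (Iso.refl _) (Iso.refl _)⟩⟩

section Boxtimes

variable {k : Type w} [Field k] {D : Type u} [Category.{v} D] [Preadditive D] [Linear k D]
  {E : Type u'} [Category.{v'} E] [Preadditive E] [Linear k E]

variable (k) in
/-- The object `X ⊠ Y` of `D ⊠ E`. -/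
@[reducible] def box (X : D) (Y : E) : Boxtimes k D E :=
  (Mat_.embedding (PureTensor k D E)).obj ⟨X, Y⟩

variable (k D) in
/-- The functor `X ↦ X ⊠ Y` to `D ⊠ E`. -/
@[reducible] def boxLeft (Y : E) : D ⥤ Boxtimes k D E :=
  PureTensor.left k D Y ⋙ Mat_.embedding (PureTensor k D E)

variable (k E) in
/-- The functor `Y ↦ X ⊠ Y` to `D ⊠ E`. -/
@[reducible] def boxRight (X : D) : E ⥤ Boxtimes k D E :=
  PureTensor.right k E X ⋙ Mat_.embedding (PureTensor k D E)

instance : (Mat_.embedding (PureTensor k D E)).Linear k where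
  map_smul _ _ := rfl

lemma boxIso_nonempty {X X' : D} {Y Y' : E} (e : X ≅ X') (e' : Y ≅ Y') :
    Nonempty (box k X Y ≅ box k X' Y') :=
  ⟨(boxLeft k D Y).mapIso e ≪≫ (boxRight k E X').mapIso e'⟩

/-- If `X' ⊠ Y'` is a retract of `X ⊠ Y` and `X'` is nonzero, then the indecomposable objects `Y'`
and `Y` are isomorphic. -/
lemma nonempty_iso_of_retract_box [IsAlgClosed k] [IsFinitaryCategory k E]
    [HasFiniteBiproducts E] {X X' : D} {Y Y' : E} (hX' : ¬ IsZero X')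
    (hY : IsIndec Y) (hY' : IsIndec Y') (r : Retract (box k X' Y') (box k X Y)) :
    Nonempty (Y' ≅ Y) := by
  obtain ⟨χ, hχ, -⟩ := hY'.exists_residue k
  let F := Mat_.embedding (PureTensor k D E)
  have r' : Retract (⟨X', Y'⟩ : PureTensor k D E) ⟨X, Y⟩ :=
    ⟨F.preimage r.i, F.preimage r.r, F.map_injective (by simp [F])⟩
  obtain ⟨a, b, hab⟩ := PureTensor.exists_isIso_of_retract hχ hX' r'
  exact (hY.isLocalObj k).nonempty_iso_of_retract
    ⟨a, b ≫ inv (a ≫ b), by rw [← Category.assoc, IsIso.hom_inv_id]⟩ hY'.1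

/-- The objects `X ⊠ Y` with `X` and `Y` indecomposable. -/
def IsIndecBox [HasFiniteBiproducts D] [HasFiniteBiproducts E] : ObjectProperty (Boxtimes k D E) :=
  fun U => ∃ (X : D) (Y : E), IsIndec X ∧ IsIndec Y ∧ U = box k X Y

variable [hD : IsFinitaryCategory k D] [hE : IsFinitaryCategory k E]

lemma finite_hom_boxtimes (U V : Boxtimes k D E) : Module.Finite k (U ⟶ V) := by
  have h : ∀ (i : U.ι) (j : V.ι), Module.Finite k (U.X i ⟶ V.X j) := fun i j => by
    have := hD.finiteDimensional (U.X i).fst (V.X j).fst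
    have := hE.finiteDimensional (U.X i).snd (V.X j).snd
    exact Module.Finite.tensorProduct k _ _
  exact inferInstanceAs (Module.Finite k (∀ (i : U.ι) (j : V.ι), U.X i ⟶ V.X j))

variable [HasFiniteBiproducts D] [HasFiniteBiproducts E]

lemma isLocalObj_box [IsAlgClosed k] {X : D} {Y : E} (hX : IsIndec X) (hY : IsIndec Y) :
    IsLocalObj (box k X Y) := by
  obtain ⟨χ, -, hχ⟩ := hY.exists_residue k
  have h := PureTensor.isLocalObj_of_residue (hX.isLocalObj k) hχ
  exact h.map _ fun h0 => h.1 (isZero_of_isZero_map _ h0)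

lemma sumOf_isIndecBox (U : Boxtimes k D E) : SumOf IsIndecBox U := by
  have : HasBinaryBiproducts (Boxtimes k D E) := hasBinaryBiproducts_of_finite_biproducts _
  have : HasZeroObject (Boxtimes k D E) := hasZeroObject_of_hasFiniteBiproducts _
  refine (SumOf.biproduct (fun i => (Mat_.embedding _).obj (U.X i)) fun i => ?_).of_iso
    (Mat_.isoBiproductEmbedding U)
  have h1 : SumOf (fun V => ∃ X : D, IsIndec X ∧ V = box k X (U.X i).snd)
      ((boxLeft k D (U.X i).snd).obj (U.X i).fst) :=
    (sumOf_isIndec k hD.finiteDimensional (U.X i).fst).map _ fun X hX => ⟨X, hX, rfl⟩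
  refine SumOf.bind ?_ h1
  rintro _ ⟨X, hX, rfl⟩
  exact (sumOf_isIndec k hE.finiteDimensional (U.X i).snd).map (boxRight k E X)
    fun Y hY => ⟨X, Y, hX, hY, rfl⟩

lemma exists_iso_box_of_isIndec [IsAlgClosed k] {U : Boxtimes k D E} (hU : IsIndec U) :
    ∃ (X : D) (Y : E), IsIndec X ∧ IsIndec Y ∧ Nonempty (U ≅ box k X Y) := by
  obtain ⟨_, ⟨X, Y, hX, hY, rfl⟩, e⟩ := (sumOf_isIndecBox U).exists_iso_of_isIndec (by
    rintro _ ⟨X, Y, hX, hY, rfl⟩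
    exact (isLocalObj_box hX hY).1) hU
  exact ⟨X, Y, hX, hY, e⟩

/-- The tensor product of two finitary categories over an algebraically closed field is finitary:
its objects are finite direct sums of the objects `X ⊠ Y` with `X` and `Y` indecomposable, and these
have local endomorphism algebras, so that idempotents split. -/
lemma isFinitaryCategory_boxtimes [IsAlgClosed k] : IsFinitaryCategory k (Boxtimes k D E) where
  hasFiniteBiproducts := inferInstance
  isIdempotentComplete := ⟨fun U e he => by
    have : HasBinaryBiproducts (Boxtimes k D E) := hasBinaryBiproducts_of_finite_biproducts _
    exact (sumOf_isIndecBox U).splits (by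
      rintro _ ⟨X, Y, hX, hY, rfl⟩
      exact isLocalObj_box hX hY) e he⟩
  finiteDimensional := finite_hom_boxtimes
  finite_indec := by
    obtain ⟨S, hS, hS'⟩ := hD.finite_indec
    obtain ⟨T, hT, hT'⟩ := hE.finite_indec
    refine ⟨Set.image2 (box k) S T, hS.image2 _ hT, fun U hU => ?_⟩
    obtain ⟨X, Y, hX, hY, ⟨e⟩⟩ := exists_iso_box_of_isIndec hU
    obtain ⟨X', hX', ⟨a⟩⟩ := hS' X hX
    obtain ⟨Y', hY', ⟨b⟩⟩ := hT' Y hY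
    exact ⟨_, Set.mem_image2_of_mem hX' hY', ⟨e ≪≫ (boxIso_nonempty a b).some⟩⟩

end Boxtimes

/-! ### Ideals described by test objects -/

/-- A fully faithful additive functor reflects locality of objects. -/
lemma IsLocalObj.of_map {D : Type u} [Category.{v} D] [Preadditive D] {E : Type u'}
    [Category.{v'} E] [Preadditive E] (F : D ⥤ E) [F.Additive] [F.Full] [F.Faithful] {X : D}
    (hX : IsLocalObj (F.obj X)) : IsLocalObj X := by
  refine ⟨fun h => hX.1 (F.map_isZero h), fun f g h => ?_⟩
  have h1 : IsIso (F.map f + F.map g) := by rw [← F.map_add]; infer_instance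
  rcases hX.2 (F.map f) (F.map g) h1 with h | h
  · exact Or.inl (isIso_of_fully_faithful F f)
  · exact Or.inr (isIso_of_fully_faithful F g)

namespace TwoRep

variable {k : Type w} [Field k] {C : Type u₁} [Bicategory.{w₁, v₁} C]

section TestIdeal

variable (M : TwoRep.{w, u₁, v₁, w₁, u, v} k C)

/-- For a class `L` of local objects, the ideal of all `f` such that no composite
`Z ⟶ F X ⟶ F Y ⟶ Z` through `F f`, with `Z` in `L`, is invertible. It is the largest ideal that
contains no identity of an object in `L`. -/
def testIdeal (L : ∀ i : C, ObjectProperty (M.obj i)) (hL : ∀ i X, L i X → IsLocalObj X) :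
    M.Ideal where
  hom {i} X Y :=
    { carrier := {f | ∀ (j : C) (F : i ⟶ j) (Z : M.obj j), L j Z →
        ∀ (g : Z ⟶ (M.map F).obj X) (h : (M.map F).obj Y ⟶ Z), ¬ IsIso (g ≫ (M.map F).map f ≫ h)}
      zero_mem' := fun j F Z hZ g h => by
        rw [Functor.map_zero, zero_comp, comp_zero]
        exact (hL j Z hZ).not_isIso_zero
      add_mem' := fun {a b} ha hb j F Z hZ g h hiso => by
        rw [Functor.map_add, Preadditive.add_comp, Preadditive.comp_add] at hiso
        exact ((hL j Z hZ).2 _ _ hiso).elim (ha j F Z hZ g h) (hb j F Z hZ g h)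
      smul_mem' := fun c a ha j F Z hZ g h => by
        rw [Functor.map_smul, Linear.smul_comp, Linear.comp_smul, ← Linear.smul_comp]
        exact ha j F Z hZ (c • g) h }
  comp_left f g hg j F Z hZ a b := by
    rw [Functor.map_comp, Category.assoc, ← Category.assoc]
    exact hg j F Z hZ _ b
  comp_right g hf j F Z hZ a b := by
    rw [Functor.map_comp, Category.assoc]
    exact hf j F Z hZ a _
  map_mem {i j} F X Y f hf l G Z hZ a b := by
    have h := Functor.congr_hom (M.map_comp F G).symm f
    rw [Functor.comp_map] at h
    rw [h, Category.assoc, Category.assoc, ← Category.assoc]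
    exact hf l (F ≫ G) Z hZ _ _

variable {M} {L : ∀ i : C, ObjectProperty (M.obj i)} {hL : ∀ i X, L i X → IsLocalObj X}

lemma id_notMem_testIdeal {i : C} {X Z : M.obj i} (hZ : L i Z) (r : Retract Z X) :
    𝟙 X ∉ (M.testIdeal L hL).hom X X := fun h => by
  have e : (M.map (𝟙 i)).obj X = X := by rw [M.map_id]; rfl
  refine h i (𝟙 i) Z hZ (r.i ≫ eqToHom e.symm) (eqToHom e ≫ r.r) ?_
  have h1 : (r.i ≫ eqToHom e.symm) ≫ (M.map (𝟙 i)).map (𝟙 X) ≫ eqToHom e ≫ r.r = 𝟙 Z := by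
    simp
  rw [h1]
  infer_instance

/-- If every nonzero object has a retract in `L`, then the largest proper ideal is the ideal of
morphisms that vanish on the test objects in `L`. -/
lemma mem_maxIdeal_iff (hret : ∀ (i : C) (X : M.obj i), ¬ IsZero X →
    ∃ Z, L i Z ∧ Nonempty (Retract Z X)) {i : C} {X Y : M.obj i} (f : X ⟶ Y) :
    f ∈ M.maxIdeal.hom X Y ↔ f ∈ (M.testIdeal L hL).hom X Y := by
  have hmax : ∀ J : M.Ideal, f ∈ M.maxIdeal.hom X Y →
      (∀ I : M.Ideal, I.IsProper → I ≤ J) → f ∈ J.hom X Y := by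
    intro J hf hJ
    simp only [maxIdeal, Ideal.sum, Ideal.inter, Submodule.mem_iInf] at hf
    exact hf J fun I hI => hJ I hI
  refine ⟨fun hf => hmax _ hf fun I hI i X Y f hf j F Z hZ g h hiso => ?_, fun hf => ?_⟩
  · have h1 : g ≫ (M.map F).map f ≫ h ∈ I.hom Z Z :=
      I.comp_left _ (I.comp_right _ (I.map_mem F hf))
    have h2 := I.comp_right (inv (g ≫ (M.map F).map f ≫ h)) h1
    rw [IsIso.hom_inv_id] at h2
    exact (hL j Z hZ).1 (hI j Z h2)
  · simp only [maxIdeal, Ideal.sum, Ideal.inter, Submodule.mem_iInf]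
    intro J hJ
    refine hJ (M.testIdeal L hL) (fun i X hX => ?_) i X Y hf
    by_contra h0
    obtain ⟨Z, hZ, ⟨r⟩⟩ := hret i X h0
    exact id_notMem_testIdeal hZ r hX

end TestIdeal

/-! ### Objects of quotients and subquotients -/

namespace Ideal

variable {M : TwoRep.{w, u₁, v₁, w₁, u, v} k C} (I : M.Ideal)

/-- The projection functors `M(i) ⥤ (M / I)(i)`. -/
def proj (i : C) : M.obj i ⥤ (M.quotient I).obj i := CategoryTheory.Quotient.functor (I.rel i)

instance (i : C) : (I.proj i).Additive :=
  inferInstanceAs (CategoryTheory.Quotient.functor (I.rel i)).Additive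

instance (i : C) : (I.proj i).Linear k :=
  inferInstanceAs ((CategoryTheory.Quotient.functor (I.rel i)).Linear k)

instance (i : C) : (I.proj i).Full :=
  inferInstanceAs (CategoryTheory.Quotient.functor (I.rel i)).Full

lemma proj_map_eq_iff {i : C} {X Y : M.obj i} (f g : X ⟶ Y) :
    (I.proj i).map f = (I.proj i).map g ↔ f - g ∈ I.hom X Y :=
  CategoryTheory.Quotient.functor_map_eq_iff (I.rel i) f g

lemma proj_map_eq_zero_iff {i : C} {X Y : M.obj i} (f : X ⟶ Y) :
    (I.proj i).map f = 0 ↔ f ∈ I.hom X Y := by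
  rw [← (I.proj i).map_zero X Y, proj_map_eq_iff, sub_zero]

lemma isZero_proj_obj_iff {i : C} (X : M.obj i) :
    IsZero ((I.proj i).obj X) ↔ 𝟙 X ∈ I.hom X X := by
  rw [IsZero.iff_id_eq_zero, ← (I.proj i).map_id, proj_map_eq_zero_iff]

end Ideal

section Subquotient

variable (M : TwoRep.{w, u₁, v₁, w₁, u, v} k C) [hM : M.IsFinitary]

lemma StableSet.isLocalObj [IsAlgClosed k] {S : M.StableSet} {i : C} {X : M.obj i}
    (hX : S.mem i X) : IsLocalObj X := by
  have := hM.finitary i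
  exact (S.isIndec hX).isLocalObj k

/-- An indecomposable object of the additive closure of a stable set belongs to the set. -/
lemma StableSet.mem_of_addClosure [IsAlgClosed k] (S : M.StableSet) {i : C} {X : M.obj i}
    (hX : IsLocalObj X) (h : addClosure (S.mem i) X) : S.mem i X := by
  obtain ⟨W, hW, ⟨r⟩⟩ := hX.exists_retract_of_addClosure h
  exact S.of_iso ((S.isLocalObj M hW).nonempty_iso_of_retract r hX.1).some.symm hW

/-- The ideal defining `M_T / M_S` contains no identity of an object in `T` outside `S`. -/
lemma not_isZero_subquotient [IsAlgClosed k] (S T : M.StableSet) {i : C} (X : (M.sub T).obj i)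
    (hT : T.mem i X.obj) (hS : ¬ S.mem i X.obj) :
    ¬ IsZero (((M.subIdeal S T).proj i).obj X) := by
  intro h0
  -- The ideal tested by the objects in `T` outside `S` contains the identities of all objects of `M_S`.
  let L : ∀ i : C, ObjectProperty ((M.sub T).obj i) := fun i X => T.mem i X.obj ∧ ¬ S.mem i X.obj
  have hL : ∀ i X, L i X → IsLocalObj X := fun i X hX =>
    IsLocalObj.of_map (addClosure (T.mem i)).ι (T.isLocalObj M hX.1)
  have h1 := ((M.subIdeal S T).isZero_proj_obj_iff X).1 h0
  simp only [subIdeal, Ideal.generatedBy, Ideal.inter, Submodule.mem_iInf] at h1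
  refine id_notMem_testIdeal (L := L) (hL := hL) ⟨hT, hS⟩ (Retract.refl X) (h1 _ ?_)
  intro j U hU l F Z hZ g h hiso
  refine hZ.2 (S.mem_of_addClosure M (T.isLocalObj M hZ.1) ?_)
  let r : Retract Z (((M.sub T).map F).obj U) := ⟨g ≫ ((M.sub T).map F).map (𝟙 U),
    h ≫ inv (g ≫ ((M.sub T).map F).map (𝟙 U) ≫ h), by
      rw [← Category.assoc, Category.assoc g]; exact IsIso.hom_inv_id _⟩
  exact addClosure_of_retract (r.map (addClosure (T.mem l)).ι) (S.addClosure_map M F hU)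

lemma isZero_subquotient (S T : M.StableSet) {i : C} (X : (M.sub T).obj i)
    (hS : addClosure (S.mem i) X.obj) : IsZero (((M.subIdeal S T).proj i).obj X) := by
  refine ((M.subIdeal S T).isZero_proj_obj_iff X).2 ?_
  simp only [subIdeal, Ideal.generatedBy, Ideal.inter, Submodule.mem_iInf]
  exact fun I hI => hI i X hS

section Sealed

variable (S T : M.StableSet)

/-- The `2`-subrepresentation `M_T`. This and `subquot` are sealed copies of `sub` and
`subquotient`, whose categories are not unfolded to full subcategories and quotients by instance
search. -/
def subrep : TwoRep.{w, u₁, v₁, w₁, u, v} k C := M.sub T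

/-- The inclusion functors of `M_T` into `M`. -/
def subrepι (i : C) : (M.subrep T).obj i ⥤ M.obj i := (addClosure (T.mem i)).ι

instance (i : C) : (M.subrepι T i).Additive := inferInstanceAs (addClosure (T.mem i)).ι.Additive

instance (i : C) : (M.subrepι T i).Full := inferInstanceAs (addClosure (T.mem i)).ι.Full

instance (i : C) : (M.subrepι T i).Faithful := inferInstanceAs (addClosure (T.mem i)).ι.Faithful

variable {T} in
/-- An object of the additive closure of `T`, as an object of `M_T`. -/
def subrepMk {i : C} (X : M.obj i) (hX : addClosure (T.mem i) X) : (M.subrep T).obj i := ⟨X, hX⟩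

lemma addClosure_subrepι_obj {i : C} (Z : (M.subrep T).obj i) :
    addClosure (T.mem i) ((M.subrepι T i).obj Z) := Z.property

/-- The subquotient `M_T / M_S`. -/
def subquot : TwoRep.{w, u₁, v₁, w₁, u, v} k C := M.subquotient S T

/-- The projection functors `M_T(i) ⥤ (M_T / M_S)(i)`. -/
def subquotProj (i : C) : (M.subrep T).obj i ⥤ (M.subquot S T).obj i :=
  CategoryTheory.Quotient.functor ((M.subIdeal S T).rel i)

instance (i : C) : (M.subquotProj S T i).Additive where
  map_add := rfl

instance (i : C) : (M.subquotProj S T i).Linear k where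
  map_smul _ _ := rfl

instance (i : C) : (M.subquotProj S T i).Full :=
  inferInstanceAs (CategoryTheory.Quotient.functor ((M.subIdeal S T).rel i)).Full

instance (i : C) : (M.subquotProj S T i).EssSurj :=
  inferInstanceAs (CategoryTheory.Quotient.functor ((M.subIdeal S T).rel i)).EssSurj

variable {T}

lemma isLocalObj_subrep [IsAlgClosed k] {i : C} {Z : (M.subrep T).obj i}
    (hT : T.mem i ((M.subrepι T i).obj Z)) : IsLocalObj Z :=
  IsLocalObj.of_map (M.subrepι T i) (T.isLocalObj _ hT)

variable {S}

/-- The indecomposable objects in `T` outside `S` remain nonzero and local in the subquotient. -/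
lemma isLocalObj_subquotProj [IsAlgClosed k] {i : C} {Z : (M.subrep T).obj i}
    (hT : T.mem i ((M.subrepι T i).obj Z)) (hS : ¬ S.mem i ((M.subrepι T i).obj Z)) :
    IsLocalObj ((M.subquotProj S T i).obj Z) :=
  (M.isLocalObj_subrep hT).map (M.subquotProj S T i) (M.not_isZero_subquotient S T Z hT hS)

lemma isZero_subquotProj {i : C} {Z : (M.subrep T).obj i}
    (hS : addClosure (S.mem i) ((M.subrepι T i).obj Z)) : IsZero ((M.subquotProj S T i).obj Z) :=
  M.isZero_subquotient S T Z hS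

end Sealed

end Subquotient

end TwoRep

/-! ### Calculus of 2-natural transformations -/

namespace TwoRep

variable {k : Type w} [Field k] {C : Type u₁} [Bicategory.{w₁, v₁} C]

attribute [instance] TwoNatTrans.app_additive TwoNatTrans.app_linear

namespace TwoNatTrans

section Comp

variable {M : TwoRep.{w, u₁, v₁, w₁, u, v} k C} {N : TwoRep.{w, u₁, v₁, w₁, u', v'} k C}

@[simp]
lemma naturality_app (Φ : TwoNatTrans M N) {i j : C} {F G : i ⟶ j} (α : F ⟶ G) (X : M.obj i) :
    (Φ.iso F).hom.app X ≫ (N.map₂ α).app ((Φ.app i).obj X) =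
      (Φ.app j).map ((M.map₂ α).app X) ≫ (Φ.iso G).hom.app X :=
  NatTrans.congr_app (Φ.naturality α) X

/-- Composition of `2`-natural transformations. -/
def comp {P : TwoRep k C} (Φ : TwoNatTrans M N) (Ψ : TwoNatTrans N P) : TwoNatTrans M P where
  app i := Φ.app i ⋙ Ψ.app i
  app_additive i := inferInstance
  app_linear i := inferInstance
  iso {i j} F := NatIso.ofComponents
    (fun X => (Ψ.app j).mapIso ((Φ.iso F).app X) ≪≫ (Ψ.iso F).app ((Φ.app i).obj X))
    (fun {X Y} f => by
      have h1 := (Φ.iso F).hom.naturality f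
      have h2 := (Ψ.iso F).hom.naturality ((Φ.app i).map f)
      simp only [Functor.comp_map] at h1 h2
      simp only [Functor.comp_map, Iso.trans_hom, Functor.mapIso_hom, Iso.app_hom, Category.assoc]
      rw [← h2, ← Category.assoc, ← Functor.map_comp, h1, Functor.map_comp, Category.assoc])
  naturality {i j F G} α := by
    ext X
    have h1 := Φ.naturality_app α X
    have h2 := Ψ.naturality_app α ((Φ.app i).obj X)
    simp only [NatTrans.comp_app, NatIso.ofComponents_hom_app, Iso.trans_hom, Functor.mapIso_hom,
      Iso.app_hom, Functor.whiskerLeft_app, Functor.whiskerRight_app, Functor.comp_map,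
      Functor.comp_obj, Category.assoc]
    rw [h2, ← Category.assoc, ← Functor.map_comp, h1, Functor.map_comp, Category.assoc]
  iso_id i X := by
    simp only [NatIso.ofComponents_hom_app, Iso.trans_hom, Functor.mapIso_hom, Iso.app_hom,
      Φ.iso_id, Ψ.iso_id, eqToHom_map, eqToHom_trans]
  iso_comp {i j l} F G X := by
    have h := (Ψ.iso G).hom.naturality ((Φ.iso F).hom.app X)
    simp only [Functor.comp_map] at h
    simp only [NatIso.ofComponents_hom_app, Iso.trans_hom, Functor.mapIso_hom, Iso.app_hom,
      Φ.iso_comp, Ψ.iso_comp, Functor.map_comp, eqToHom_map, Category.assoc, eqToHom_trans_assoc,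
      eqToHom_refl, Category.id_comp]
    rw [reassoc_of% h]

/-- A family of functors that commutes strictly with the action of `C`. -/
def ofStrict (app : ∀ i : C, M.obj i ⥤ N.obj i) [∀ i, (app i).Additive] [∀ i, (app i).Linear k]
    (h : ∀ {i j : C} (F : i ⟶ j), M.map F ⋙ app j = app i ⋙ N.map F)
    (h₂ : ∀ {i j : C} {F G : i ⟶ j} (α : F ⟶ G) (X : M.obj i),
      (app j).map ((M.map₂ α).app X) = eqToHom (Functor.congr_obj (h F) X) ≫
        (N.map₂ α).app ((app i).obj X) ≫ eqToHom (Functor.congr_obj (h G) X).symm) :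
    TwoNatTrans M N where
  app := app
  app_additive i := inferInstance
  app_linear i := inferInstance
  iso F := eqToIso (h F)
  naturality α := by
    ext X
    simp only [eqToIso.hom, NatTrans.comp_app, eqToHom_app, Functor.whiskerLeft_app,
      Functor.whiskerRight_app, h₂, Category.assoc, eqToHom_trans]
    simp
  iso_id i X := by simp only [eqToIso.hom, eqToHom_app]
  iso_comp F G X := by simp only [eqToIso.hom, eqToHom_app, eqToHom_map, eqToHom_trans]

section Inverse

variable (Φ : TwoNatTrans M N) [∀ i, (Φ.app i).Full] [∀ i, (Φ.app i).Faithful]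
  {G : ∀ i : C, N.obj i ⥤ M.obj i} (c : ∀ (i : C) (Y : N.obj i), (Φ.app i).obj ((G i).obj Y) ≅ Y)

/-- The structure isomorphisms of the inverse of `Φ`: their images under `Φ` are composed of the
isomorphisms `c` and the inverse structure isomorphisms of `Φ`. -/
def inverseIso {i j : C} (F : i ⟶ j) (Y : N.obj i) :
    (G j).obj ((N.map F).obj Y) ≅ (M.map F).obj ((G i).obj Y) :=
  (Φ.app j).preimageIso (c j ((N.map F).obj Y) ≪≫ (N.map F).mapIso (c i Y).symm ≪≫
    ((Φ.iso F).app ((G i).obj Y)).symm)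

lemma map_inverseIso_hom {i j : C} (F : i ⟶ j) (Y : N.obj i) :
    (Φ.app j).map (Φ.inverseIso c F Y).hom = (c j ((N.map F).obj Y)).hom ≫
      (N.map F).map (c i Y).inv ≫ (Φ.iso F).inv.app ((G i).obj Y) :=
  (Φ.app j).map_preimage _

variable (hc : ∀ (i : C) {Y Y' : N.obj i} (f : Y ⟶ Y'),
  (Φ.app i).map ((G i).map f) ≫ (c i Y').hom = (c i Y).hom ≫ f)

omit [∀ i, (Φ.app i).Full] [∀ i, (Φ.app i).Faithful] in
include hc in
lemma inv_naturality (i : C) {Y Y' : N.obj i} (f : Y ⟶ Y') :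
    f ≫ (c i Y').inv = (c i Y).inv ≫ (Φ.app i).map ((G i).map f) := by
  rw [Iso.eq_inv_comp, ← Category.assoc, ← hc, Category.assoc, Iso.hom_inv_id, Category.comp_id]

/-- The `2`-natural transformation formed by quasi-inverses of the components of `Φ`. -/
def inverse [∀ i, (G i).Additive] [∀ i, (G i).Linear k] : TwoNatTrans N M where
  app i := G i
  app_additive i := inferInstance
  app_linear i := inferInstance
  iso {i j} F := NatIso.ofComponents (Φ.inverseIso c F) (fun {Y Y'} f => by
    apply (Φ.app j).map_injective
    have h3 := (Φ.iso F).inv.naturality ((G i).map f)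
    simp only [Functor.comp_map] at h3
    simp only [Functor.map_comp, map_inverseIso_hom, Functor.comp_map, Category.assoc]
    rw [← h3, reassoc_of% hc j ((N.map F).map f), ← Functor.map_comp_assoc,
      inv_naturality Φ c hc, Functor.map_comp_assoc])
  naturality {i j F F'} α := by
    ext Y
    apply (Φ.app j).map_injective
    have h2 := (N.map₂ α).naturality (c i Y).inv
    have h3 := Φ.naturality_app α ((G i).obj Y)
    have h4 := (Φ.iso F).inv_hom_id_app ((G i).obj Y)
    have h5 := (Φ.iso F').hom_inv_id_app ((G i).obj Y)
    simp only [Functor.comp_obj] at h4 h5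
    simp only [NatTrans.comp_app, NatIso.ofComponents_hom_app, Functor.whiskerLeft_app,
      Functor.whiskerRight_app, Functor.map_comp, map_inverseIso_hom, Category.assoc]
    rw [reassoc_of% hc j ((N.map₂ α).app Y), ← reassoc_of% h2]
    have h6 : (Φ.iso F).inv.app ((G i).obj Y) ≫ (Φ.app j).map ((M.map₂ α).app ((G i).obj Y)) =
        (N.map₂ α).app ((Φ.app i).obj ((G i).obj Y)) ≫ (Φ.iso F').inv.app ((G i).obj Y) := by
      rw [← cancel_mono ((Φ.iso F').hom.app ((G i).obj Y)), Category.assoc, ← h3,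
        reassoc_of% h4, Category.assoc, (Φ.iso F').inv_hom_id_app]
      exact (Category.comp_id _).symm
    rw [h6]
  iso_id i Y := by
    apply (Φ.app i).map_injective
    have h1 : (N.map (𝟙 i)).obj Y = Y := by rw [N.map_id]; rfl
    have h2 : ∀ {Y Y' : N.obj i} (h : Y = Y'), (c i Y).hom =
        eqToHom (by rw [h]) ≫ (c i Y').hom ≫ eqToHom h.symm := by
      rintro Y _ rfl; simp
    have h3 := Functor.congr_hom (N.map_id i) (c i Y).inv
    have h4 : (Φ.iso (𝟙 i)).inv.app ((G i).obj Y) = eqToHom (by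
        simp only [Functor.comp_obj, M.map_id, N.map_id, Functor.id_obj]) := by
      rw [← cancel_epi ((Φ.iso (𝟙 i)).hom.app ((G i).obj Y)), Iso.hom_inv_id_app, Φ.iso_id,
        eqToHom_trans, eqToHom_refl]
    simp only [NatIso.ofComponents_hom_app, map_inverseIso_hom, eqToHom_map, h2 h1, h3, h4,
      Functor.id_map, Category.assoc, eqToHom_trans, eqToHom_trans_assoc, eqToHom_refl,
      Category.id_comp, Iso.hom_inv_id_assoc]
  iso_comp {i j l} F F' Y := by
    apply (Φ.app l).map_injective
    have h2 : ∀ {Y Y' : N.obj l} (h : Y = Y'), (c l Y).hom =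
        eqToHom (by rw [h]) ≫ (c l Y').hom ≫ eqToHom h.symm := by
      rintro Y _ rfl; simp
    have h1 : (N.map (F ≫ F')).obj Y = (N.map F').obj ((N.map F).obj Y) := by
      rw [N.map_comp]; rfl
    have h3 := Functor.congr_hom (N.map_comp F F') (c i Y).inv
    have h4 : (Φ.iso (F ≫ F')).inv.app ((G i).obj Y) =
        eqToHom (by simp only [Functor.comp_obj, N.map_comp]) ≫
          (N.map F').map ((Φ.iso F).inv.app ((G i).obj Y)) ≫
          (Φ.iso F').inv.app ((M.map F).obj ((G i).obj Y)) ≫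
          eqToHom (by simp only [Functor.comp_obj, M.map_comp]) := by
      have h5 := (Φ.iso F').hom_inv_id_app ((M.map F).obj ((G i).obj Y))
      have h6 := (Φ.iso F).hom_inv_id_app ((G i).obj Y)
      rw [← cancel_epi ((Φ.iso (F ≫ F')).hom.app ((G i).obj Y)), Iso.hom_inv_id_app, Φ.iso_comp]
      simp only [Category.assoc, eqToHom_trans_assoc, eqToHom_refl, Category.id_comp]
      have h7 : (N.map F').map ((Φ.iso F).hom.app ((G i).obj Y)) ≫
          (N.map F').map ((Φ.iso F).inv.app ((G i).obj Y)) = 𝟙 _ := by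
        rw [← Functor.map_comp, h6]; exact CategoryTheory.Functor.map_id _ _
      simp only [Functor.comp_obj] at h5
      rw [reassoc_of% h7, reassoc_of% h5, eqToHom_trans, eqToHom_refl]
    have h7 := (Φ.iso F').inv.naturality (Φ.inverseIso c F Y).hom
    simp only [Functor.comp_map, map_inverseIso_hom] at h7
    simp only [NatIso.ofComponents_hom_app, map_inverseIso_hom, Functor.map_comp, eqToHom_map, h4,
      h2 h1, h3, Category.assoc, eqToHom_trans_assoc, eqToHom_refl, Category.id_comp]
    have h8 : (N.map F').map (c j ((N.map F).obj Y)).inv ≫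
        (N.map F').map (c j ((N.map F).obj Y)).hom = 𝟙 _ := by
      rw [← Functor.map_comp, Iso.inv_hom_id]; exact CategoryTheory.Functor.map_id _ _
    rw [← reassoc_of% h7]
    simp only [Functor.map_comp, Functor.comp_map, Category.assoc]
    rw [reassoc_of% h8]

end Inverse

end Comp

section Quotient

variable {M : TwoRep.{w, u₁, v₁, w₁, u, v} k C}

/-- The projection of a `2`-representation to its quotient by an ideal. -/
def proj (I : M.Ideal) : TwoNatTrans M (M.quotient I) :=
  ofStrict I.proj (fun _ => rfl) fun _ _ =>
    ((Category.id_comp _).trans (Category.comp_id _)).symm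

/-- The factorization of a `2`-natural transformation through the quotient by an ideal that it
kills. -/
def lift {N : TwoRep.{w, u₁, v₁, w₁, u', v'} k C} (Φ : TwoNatTrans M N) (I : M.Ideal)
    (h : ∀ (i : C) (X Y : M.obj i) (f : X ⟶ Y), f ∈ I.hom X Y → (Φ.app i).map f = 0) :
    TwoNatTrans (M.quotient I) N where
  app i := CategoryTheory.Quotient.lift (I.rel i) (Φ.app i) fun X Y f g hfg => by
    rw [← sub_eq_zero, ← Functor.map_sub]
    exact h i X Y _ hfg
  app_additive i := ⟨by
    rintro ⟨X⟩ ⟨Y⟩ ⟨f⟩ ⟨g⟩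
    exact (Φ.app i).map_add⟩
  app_linear i := ⟨by
    rintro ⟨X⟩ ⟨Y⟩ ⟨f⟩ c
    exact (Φ.app i).map_smul c f⟩
  iso {i j} F := CategoryTheory.Quotient.natIsoLift _ (Φ.iso F)
  naturality α := by
    apply CategoryTheory.Quotient.natTrans_ext
    exact Φ.naturality α
  iso_id i X := Φ.iso_id i X.as
  iso_comp F G X := Φ.iso_comp F G X.as

end Quotient

end TwoNatTrans

/-- The projection functors of a subrepresentation to a subquotient commute with the action. -/
def subquotNat (M : TwoRep.{w, u₁, v₁, w₁, u, v} k C) [M.IsFinitary] (S T : M.StableSet) :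
    TwoNatTrans (M.subrep T) (M.subquot S T) :=
  TwoNatTrans.ofStrict (M.subquotProj S T) (fun _ => rfl) fun _ _ =>
    ((Category.id_comp _).trans (Category.comp_id _)).symm

lemma Equivalent.symm {M : TwoRep.{w, u₁, v₁, w₁, u, v} k C}
    {N : TwoRep.{w, u₁, v₁, w₁, u', v'} k C} (h : Equivalent M N) : Equivalent N M := by
  obtain ⟨Φ, hΦ⟩ := h
  have h1 : ∀ i, (Φ.app i).asEquivalence.inverse.Additive := fun i =>
    haveI : (Φ.app i).asEquivalence.functor.Additive := Φ.app_additive i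
    (Φ.app i).asEquivalence.inverse_additive
  have h2 : ∀ i, (Φ.app i).asEquivalence.inverse.Linear k := fun i =>
    haveI : (Φ.app i).asEquivalence.functor.Additive := Φ.app_additive i
    haveI : (Φ.app i).asEquivalence.functor.Linear k := Φ.app_linear i
    (Φ.app i).asEquivalence.inverseLinear k
  exact ⟨Φ.inverse (G := fun i => (Φ.app i).asEquivalence.inverse)
    (fun i Y => (Φ.app i).asEquivalence.counitIso.app Y)
    (fun i _ _ f => (Φ.app i).asEquivalence.counitIso.hom.naturality f),
    fun i => inferInstanceAs (Φ.app i).asEquivalence.inverse.IsEquivalence⟩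

lemma Equivalent.trans {M : TwoRep.{w, u₁, v₁, w₁, u, v} k C}
    {N : TwoRep.{w, u₁, v₁, w₁, u', v'} k C} {P : TwoRep.{w, u₁, v₁, w₁, u'', v''} k C}
    (h : Equivalent M N) (h' : Equivalent N P) : Equivalent M P := by
  obtain ⟨Φ, hΦ⟩ := h
  obtain ⟨Ψ, hΨ⟩ := h'
  exact ⟨Φ.comp Ψ, fun i => inferInstanceAs (Φ.app i ⋙ Ψ.app i).IsEquivalence⟩

end TwoRep

/-! ### The action of a 2-representation on its inflation -/

/-- Fully faithful additive functors reflect direct sums. -/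
def Splitting.ofMap {D : Type u} [Category.{v} D] [Preadditive D] {E : Type u'}
    [Category.{v'} E] [Preadditive E] (F : D ⥤ E) [F.Additive] [F.Full] [F.Faithful] {Z X Y : D}
    (s : Splitting (F.obj Z) (F.obj X) (F.obj Y)) : Splitting Z X Y where
  inl := F.preimage s.inl
  inr := F.preimage s.inr
  fst := F.preimage s.fst
  snd := F.preimage s.snd
  inl_fst := F.map_injective (by simp)
  inr_snd := F.map_injective (by simp)
  total := F.map_injective (by simp [F.map_add, s.total])

lemma SumOf.addClosure {D : Type u} [Category.{v} D] [Preadditive D] [HasFiniteBiproducts D]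
    {P : ObjectProperty D} {X : D} (h : SumOf P X) : addClosure P X := by
  induction h with
  | zero h => exact ⟨0, Fin.elim0, fun a => a.elim0, ⟨⟨0, 0, h.eq_of_src _ _⟩⟩⟩
  | @cons Z X Y hX _ s ih =>
    let g : Bool → D := fun b => cond b X Y
    refine addClosure_of_retract (Y := ⨁ g)
      ⟨s.fst ≫ biproduct.ι g true + s.snd ≫ biproduct.ι g false,
        biproduct.π g true ≫ s.inl + biproduct.π g false ≫ s.inr, ?_⟩
      (addClosure_biproduct g fun b => by
        cases b
        · exact ih
        · exact le_addClosure hX)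
    simp only [Preadditive.add_comp, Preadditive.comp_add, Category.assoc,
      biproduct.ι_π_self_assoc]
    rw [biproduct.ι_π_ne_assoc g (by decide : true ≠ false),
      biproduct.ι_π_ne_assoc g (by decide : false ≠ true)]
    simpa [g] using s.total

namespace TwoRep

variable {k : Type w} [Field k] {C : Type u₁} [Bicategory.{w₁, v₁} C]
  (M : TwoRep.{w, u₁, v₁, w₁, u, v} k C)
  {A : Type u'} [Category.{v'} A] [Preadditive A] [Linear k A]

lemma isFinitary_inflation [IsAlgClosed k] [hM : M.IsFinitary] [hA : IsFinitaryCategory k A] :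
    (M.inflation A).IsFinitary where
  finitary i := by
    have := hM.finitary i
    have := hA.hasFiniteBiproducts
    exact isFinitaryCategory_boxtimes

lemma sumOf_isIndec_obj [hM : M.IsFinitary] {i : C} (X : M.obj i) :
    SumOf (fun Z => IsIndec Z) X :=
  sumOf_isIndec k (hM.finitary i).finiteDimensional X

lemma isLocalObj_of_isIndec [IsAlgClosed k] [hM : M.IsFinitary] {i : C} {X : M.obj i}
    (hX : IsIndec X) : IsLocalObj X := by
  have := hM.finitary i
  exact hX.isLocalObj k

section Tens

section

variable [(M.inflation A).IsFinitary] (T : (M.inflation A).StableSet) (i : C)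

-- Instance search unfolds the categories of an inflation, so that the general instances for
-- `subrepι` do not apply.
instance : ((M.inflation A).subrepι T i).Additive :=
  inferInstanceAs (addClosure (T.mem i)).ι.Additive

instance : ((M.inflation A).subrepι T i).Full := inferInstanceAs (addClosure (T.mem i)).ι.Full

instance : ((M.inflation A).subrepι T i).Faithful :=
  inferInstanceAs (addClosure (T.mem i)).ι.Faithful

end

variable [(M.inflation A).IsFinitary] (T : (M.inflation A).StableSet) {Y : A}
  (h : ∀ (i : C) (X : M.obj i), addClosure (T.mem i) (box k X Y))

/-- The functor `X ↦ X ⊠ Y` to the additive closure of a stable set. -/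
@[reducible] def tensFunctor (i : C) : M.obj i ⥤ ((M.inflation A).subrep T).obj i :=
  (addClosure (T.mem i)).lift (boxLeft k (M.obj i) Y) (h i)

instance (i : C) : (tensFunctor M T h i).Additive where
  map_add := by intros; exact ObjectProperty.hom_ext _ (boxLeft k (M.obj i) Y).map_add

instance (i : C) : (tensFunctor M T h i).Linear k where
  map_smul f c := ObjectProperty.hom_ext _ ((boxLeft k (M.obj i) Y).map_smul c f)

lemma boxNat_app_box {D₁ : Type u} [Category.{v} D₁] [Preadditive D₁] [Linear k D₁]
    {D₂ : Type u} [Category.{v} D₂] [Preadditive D₂] [Linear k D₂] {F G : D₁ ⥤ D₂} [F.Additive]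
    [F.Linear k] [G.Additive] [G.Linear k] (α : F ⟶ G) (X : D₁) (Y : A) :
    (boxNat k A α).app (box k X Y) = (boxLeft k D₂ Y).map (α.app X) := by
  funext i j
  have h₁ : (𝟙 (box k X Y) : box k X Y ⟶ box k X Y) i j = 𝟙 (⟨X, Y⟩ : PureTensor k D₁ A) :=
    congrFun (congrFun ((Mat_.embedding (PureTensor k D₁ A)).map_id ⟨X, Y⟩).symm i) j
  have h₂ : (PureTensor.mapNat (k := k) (E := A) α).app ⟨X, Y⟩ ≫
      (PureTensor.map G).map (𝟙 (⟨X, Y⟩ : PureTensor k D₁ A)) =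
        (PureTensor.mapNat (k := k) (E := A) α).app ⟨X, Y⟩ := by
    rw [CategoryTheory.Functor.map_id, Category.comp_id]
  exact (congrArg (fun t => (PureTensor.mapNat (k := k) (E := A) α).app ⟨X, Y⟩ ≫
    (PureTensor.map G).map t) h₁).trans h₂

/-- The `2`-natural transformation `X ↦ X ⊠ Y`. -/
def tens : TwoNatTrans M ((M.inflation A).subrep T) :=
  TwoNatTrans.ofStrict (tensFunctor M T h) (fun F => rfl) fun {i j F G} α X => by
    refine Eq.trans ?_ ((Category.id_comp _).trans (Category.comp_id _)).symm
    exact ObjectProperty.hom_ext _ (boxNat_app_box (M.map₂ α) X Y).symm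

/-- The morphism in the additive closure of a stable set defined by a morphism of pure tensors. -/
def tensHom {i : C} {X₁ X₂ : M.obj i}
    (t : (⟨X₁, Y⟩ : PureTensor k (M.obj i) A) ⟶ ⟨X₂, Y⟩) :
    (tensFunctor M T h i).obj X₁ ⟶ (tensFunctor M T h i).obj X₂ :=
  ObjectProperty.homMk ((Mat_.embedding (PureTensor k (M.obj i) A)).map t)

lemma tensHom_comp {i : C} {X₁ X₂ X₃ : M.obj i}
    (t : (⟨X₁, Y⟩ : PureTensor k (M.obj i) A) ⟶ ⟨X₂, Y⟩)
    (t' : (⟨X₂, Y⟩ : PureTensor k (M.obj i) A) ⟶ ⟨X₃, Y⟩) :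
    tensHom M T h (t ≫ t') = tensHom M T h t ≫ tensHom M T h t' :=
  ObjectProperty.hom_ext _ ((Mat_.embedding (PureTensor k (M.obj i) A)).map_comp t t')

lemma tensHom_sub {i : C} {X₁ X₂ : M.obj i}
    (t t' : (⟨X₁, Y⟩ : PureTensor k (M.obj i) A) ⟶ ⟨X₂, Y⟩) :
    tensHom M T h (t - t') = tensHom M T h t - tensHom M T h t' := rfl

lemma tensHom_surjective {i : C} {X₁ X₂ : M.obj i}
    (f : (tensFunctor M T h i).obj X₁ ⟶ (tensFunctor M T h i).obj X₂) :
    ∃ t : (⟨X₁, Y⟩ : PureTensor k (M.obj i) A) ⟶ ⟨X₂, Y⟩, tensHom M T h t = f := by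
  obtain ⟨t, ht⟩ := (Mat_.embedding (PureTensor k (M.obj i) A)).map_surjective
    (show (Mat_.embedding (PureTensor k (M.obj i) A)).obj ⟨X₁, Y⟩ ⟶
      (Mat_.embedding (PureTensor k (M.obj i) A)).obj ⟨X₂, Y⟩ from f.hom)
  exact ⟨t, ObjectProperty.hom_ext _ ht⟩

lemma isIso_tensHom_iff {i : C} {X : M.obj i}
    (t : (⟨X, Y⟩ : PureTensor k (M.obj i) A) ⟶ ⟨X, Y⟩) : IsIso (tensHom M T h t) ↔ IsIso t := by
  refine ⟨fun ht => ?_, fun ht => ?_⟩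
  · have h1 : IsIso (((M.inflation A).subrepι T i).map (tensHom M T h t)) := inferInstance
    exact @isIso_of_fully_faithful _ _ _ _ (Mat_.embedding (PureTensor k (M.obj i) A)) _ _ _ _ t h1
  · have h1 : IsIso ((Mat_.embedding (PureTensor k (M.obj i) A)).map t) := inferInstance
    exact @isIso_of_fully_faithful _ _ _ _ ((M.inflation A).subrepι T i) _ _ _ _
      (tensHom M T h t) h1

end Tens

end TwoRep

namespace TwoRep

variable {k : Type w} [Field k] {C : Type u₁} [Bicategory.{w₁, v₁} C]
  (M : TwoRep.{w, u₁, v₁, w₁, u, v} k C)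
  {A : Type u'} [Category.{v'} A] [Preadditive A] [Linear k A]

/-! ### Simple transitive subquotients of an inflation -/

lemma StableSet.addClosure_box [M.IsFinitary] (T : (M.inflation A).StableSet) {Y : A}
    (hT : ∀ (i : C) (X : M.obj i), IsIndec X → T.mem i (box k X Y)) (i : C) (X : M.obj i) :
    addClosure (T.mem i) (box k X Y) :=
  ((sumOf_isIndec_obj M X).map (boxLeft k (M.obj i) Y) (Q := T.mem i) (hT i)).addClosure

section Subquotients

variable [IsAlgClosed k] [hM : M.IsFinitary] [IsFinitaryCategory k A] [HasFiniteBiproducts A]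
  [(M.inflation A).IsFinitary]

omit [(M.inflation A).IsFinitary] in
lemma isLocalObj_inflation {i : C} {X : M.obj i} {Y : A} (hX : IsIndec X) (hY : IsIndec Y) :
    IsLocalObj (box k X Y) := by
  have := hM.finitary i
  exact isLocalObj_box hX hY

omit [(M.inflation A).IsFinitary] in
/-- If `M` is transitive, then membership of `X ⊠ Y` in a stable set depends only on `Y`. -/
lemma StableSet.mem_box_of_mem_box (hMt : M.IsTransitive) (S : (M.inflation A).StableSet) {i j : C}
    {X : M.obj i} {X' : M.obj j} {Y : A} (hX : IsIndec X) (hX' : IsIndec X') (hY : IsIndec Y)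
    (hS : S.mem i (box k X Y)) : S.mem j (box k X' Y) := by
  obtain ⟨_, ⟨F, rfl⟩, ⟨r⟩⟩ := (isLocalObj_of_isIndec M hX').exists_retract_of_addClosure
    (hMt i X hX.1 j X')
  exact S.stable F hS (isLocalObj_inflation M hX' hY).isIndec ⟨r.map (boxLeft k (M.obj j) Y)⟩

omit hM in
/-- In a transitive subquotient only one isomorphism class of indecomposable objects `Y` of `A`
occurs in the nonzero indecomposable objects `X ⊠ Y`. -/
lemma nonempty_iso_of_isTransitive (S T : (M.inflation A).StableSet)
    (hQ : ((M.inflation A).subquotient S T).IsTransitive) {i j : C} {X : M.obj i} {X' : M.obj j}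
    {Y Y' : A} (hX' : IsIndec X') (hY : IsIndec Y) (hY' : IsIndec Y')
    (hT : T.mem i (box k X Y)) (hS : ¬ S.mem i (box k X Y))
    (hT' : T.mem j (box k X' Y')) (hS' : ¬ S.mem j (box k X' Y')) : Nonempty (Y' ≅ Y) := by
  let Z := (M.inflation A).subrepMk (T := T) (box k X Y) (le_addClosure hT)
  let Z' := (M.inflation A).subrepMk (T := T) (box k X' Y') (le_addClosure hT')
  let π (l : C) := (M.inflation A).subquotProj S T l
  have hZ : IsLocalObj ((π i).obj Z) := (M.inflation A).isLocalObj_subquotProj (Z := Z) hT hS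
  have hZ' : IsLocalObj ((π j).obj Z') :=
    (M.inflation A).isLocalObj_subquotProj (Z := Z') hT' hS'
  have hQ' : ((M.inflation A).subquot S T).IsTransitive := hQ
  obtain ⟨_, ⟨F, rfl⟩, ⟨r⟩⟩ := hZ'.exists_retract_of_addClosure
    (hQ' i ((π i).obj Z) hZ.1 j ((π j).obj Z'))
  -- The retraction lifts from the subquotient, since `Z'` is local.
  let FZ := (((M.inflation A).subrep T).map F).obj Z
  obtain ⟨a, ha⟩ := ((M.inflation A).subquotProj S T j).map_surjective
    (show (π j).obj Z' ⟶ (π j).obj FZ from r.i)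
  obtain ⟨b, hb⟩ := ((M.inflation A).subquotProj S T j).map_surjective
    (show (π j).obj FZ ⟶ (π j).obj Z' from r.r)
  have hab : IsIso (a ≫ b) := by
    have h1 : ((M.inflation A).subquotProj S T j).map (a ≫ b) = 𝟙 _ := by
      rw [((M.inflation A).subquotProj S T j).map_comp, ha, hb]; exact r.retract
    have h2 : IsIso (((M.inflation A).subquotProj S T j).map (a ≫ b)) := by rw [h1]; infer_instance
    exact ((M.inflation A).isLocalObj_subrep (Z := Z') hT').isIso_of_map _ hZ'.1 _
  let q : Retract Z' FZ :=
    ⟨a, b ≫ inv (a ≫ b), by rw [← Category.assoc, IsIso.hom_inv_id]⟩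
  exact nonempty_iso_of_retract_box (X := (M.map F).obj X) hX'.1 hY hY'
    (q.map ((M.inflation A).subrepι T j))

section

variable (S T : (M.inflation A).StableSet) {Y : A} (hY : IsIndec Y)
  (hT : ∀ (i : C) (X : M.obj i), IsIndec X → T.mem i (box k X Y))
  (hS : ∀ (i : C) (X : M.obj i), IsIndec X → ¬ S.mem i (box k X Y))
  (hTS : ∀ (i : C) (X' : M.obj i) (Y' : A), IsIndec X' → IsIndec Y' → T.mem i (box k X' Y') →
    ¬ S.mem i (box k X' Y') → Nonempty (Y' ≅ Y))

/-- The `2`-natural transformation `X ↦ X ⊠ Y` to a subquotient of the inflation. -/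
def tensProj : TwoNatTrans M ((M.inflation A).subquot S T) :=
  (tens M T (T.addClosure_box M hT)).comp ((M.inflation A).subquotNat S T)

include hTS in
/-- In the subquotient all objects are finite direct sums of objects `X ⊠ Y`, that is, of the form
`X ⊠ Y`. -/
lemma essSurj_tensProj (i : C) : ((tensProj M S T hT).app i).EssSurj := by
  have := hM.finitary i
  have : HasBinaryBiproducts (M.obj i) := hasBinaryBiproducts_of_finite_biproducts _
  obtain ⟨Z₀, hZ₀⟩ : HasZeroObject (M.obj i) := hasZeroObject_of_hasFiniteBiproducts _
  have key : ∀ W : Boxtimes k (M.obj i) A, SumOf IsIndecBox W → ∀ hW : addClosure (T.mem i) W,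
      ∃ V : M.obj i, Nonempty (((tensProj M S T hT).app i).obj V ≅
        ((M.inflation A).subquotProj S T i).obj ((M.inflation A).subrepMk W hW)) := by
    intro W hsum
    have hz : ∀ Z : ((M.inflation A).subquot S T).obj i, IsZero Z →
        ∃ V : M.obj i, Nonempty (((tensProj M S T hT).app i).obj V ≅ Z) := fun Z hZ =>
      ⟨Z₀, ⟨(Functor.map_isZero ((tensProj M S T hT).app i) hZ₀).iso hZ⟩⟩
    induction hsum with
    | zero h =>
      exact fun hW => hz _ (Functor.map_isZero ((M.inflation A).subquotProj S T i)
        (isZero_of_isZero_map ((M.inflation A).subrepι T i) h))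
    | @cons Z X V hX _ s ih =>
      intro hW
      have hXT := addClosure_of_retract s.retractFst hW
      have hVT := addClosure_of_retract s.retractSnd hW
      obtain ⟨V', ⟨e⟩⟩ := ih hVT
      have hX' : ∃ V : M.obj i,
          Nonempty (((tensProj M S T hT).app i).obj V ≅
            ((M.inflation A).subquotProj S T i).obj ((M.inflation A).subrepMk X hXT)) := by
        obtain ⟨X₁, Y₁, hX₁, hY₁, rfl⟩ := hX
        by_cases hXS : S.mem i (box k X₁ Y₁)
        · exact hz _ ((M.inflation A).isZero_subquotProj (le_addClosure hXS))
        · obtain ⟨e'⟩ := hTS i X₁ Y₁ hX₁ hY₁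
            (T.mem_of_addClosure _ (isLocalObj_inflation M hX₁ hY₁) hXT) hXS
          exact ⟨X₁, ⟨((M.inflation A).subquotProj S T i).mapIso
            (((M.inflation A).subrepι T i).preimageIso
              (boxIso_nonempty (Iso.refl X₁) e'.symm).some)⟩⟩
      obtain ⟨X', ⟨e'⟩⟩ := hX'
      let s' : Splitting ((M.inflation A).subrepMk Z hW) ((M.inflation A).subrepMk X hXT)
          ((M.inflation A).subrepMk V hVT) :=
        Splitting.ofMap ((M.inflation A).subrepι T i) s
      exact ⟨X' ⊞ V', ⟨((Splitting.ofBiprod X' V').map ((tensProj M S T hT).app i)).iso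
        (s'.map ((M.inflation A).subquotProj S T i)) e' e⟩⟩
  refine ⟨fun Z => ?_⟩
  let Z' := ((M.inflation A).subquotProj S T i).objPreimage Z
  obtain ⟨V, ⟨e⟩⟩ := key (((M.inflation A).subrepι T i).obj Z')
    (sumOf_isIndecBox _) ((M.inflation A).addClosure_subrepι_obj T Z')
  exact ⟨V, ⟨e ≪≫ ((M.inflation A).subquotProj S T i).objObjPreimageIso Z⟩⟩

end

end Subquotients

end TwoRep

namespace TwoRep

variable {k : Type w} [Field k] {C : Type u₁} [Bicategory.{w₁, v₁} C]

/-! ### Comparison of simple transitive quotients -/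

/-- A `2`-natural transformation that is essentially surjective and, modulo ideals that correspond
to each other, full induces an equivalence of the quotients. -/
lemma equivalent_quotient {M : TwoRep.{w, u₁, v₁, w₁, u, v} k C}
    {P : TwoRep.{w, u₁, v₁, w₁, u', v'} k C} (Θ : TwoNatTrans M P) (I : M.Ideal) (J : P.Ideal)
    (hsurj : ∀ i, (Θ.app i).EssSurj)
    (hIJ : ∀ (i : C) (X Y : M.obj i) (f : X ⟶ Y),
      f ∈ I.hom X Y ↔ (Θ.app i).map f ∈ J.hom ((Θ.app i).obj X) ((Θ.app i).obj Y))
    (hfull : ∀ (i : C) (X Y : M.obj i) (g : (Θ.app i).obj X ⟶ (Θ.app i).obj Y),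
      ∃ f, g - (Θ.app i).map f ∈ J.hom ((Θ.app i).obj X) ((Θ.app i).obj Y)) :
    Equivalent (M.quotient I) (P.quotient J) := by
  let Ψ := (Θ.comp (TwoNatTrans.proj J)).lift I fun i X Y f hf =>
    (J.proj_map_eq_zero_iff _).2 ((hIJ i X Y f).1 hf)
  refine ⟨Ψ, fun i => ?_⟩
  have hess : (Ψ.app i).EssSurj := ⟨fun ⟨Z⟩ =>
    ⟨⟨(Θ.app i).objPreimage Z⟩, ⟨(J.proj i).mapIso ((Θ.app i).objObjPreimageIso Z)⟩⟩⟩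
  have hF : (Ψ.app i).Full := ⟨by
    rintro ⟨X⟩ ⟨Y⟩ g
    obtain ⟨g, rfl⟩ := (J.proj i).map_surjective
      (show (J.proj i).obj ((Θ.app i).obj X) ⟶ (J.proj i).obj ((Θ.app i).obj Y) from g)
    obtain ⟨f, hf⟩ := hfull i X Y g
    exact ⟨(I.proj i).map f, ((J.proj_map_eq_iff _ _).2 hf).symm⟩⟩
  have hf : (Ψ.app i).Faithful := ⟨by
    rintro ⟨X⟩ ⟨Y⟩ f g hfg
    obtain ⟨f, rfl⟩ := (I.proj i).map_surjective
      (show (I.proj i).obj X ⟶ (I.proj i).obj Y from f)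
    obtain ⟨g, rfl⟩ := (I.proj i).map_surjective
      (show (I.proj i).obj X ⟶ (I.proj i).obj Y from g)
    refine (I.proj_map_eq_iff _ _).2 ((hIJ i X Y _).2 ?_)
    rw [Functor.map_sub]
    exact (J.proj_map_eq_iff _ _).1 hfg⟩
  exact { }

variable (M : TwoRep.{w, u₁, v₁, w₁, u, v} k C)
  {A : Type u'} [Category.{v'} A] [Preadditive A] [Linear k A]
  [hM : M.IsFinitary] [(M.inflation A).IsFinitary]
  (S T : (M.inflation A).StableSet) {Y : A}
  (hT : ∀ (i : C) (X : M.obj i), IsIndec X → T.mem i (box k X Y))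

/-- The morphism in the subquotient defined by a morphism of pure tensors. -/
def tensProjHom {i : C} {X₁ X₂ : M.obj i}
    (t : (⟨X₁, Y⟩ : PureTensor k (M.obj i) A) ⟶ ⟨X₂, Y⟩) :
    ((tensProj M S T hT).app i).obj X₁ ⟶ ((tensProj M S T hT).app i).obj X₂ :=
  ((M.inflation A).subquotProj S T i).map (tensHom M T (T.addClosure_box M hT) t)

lemma tensProjHom_left {i : C} {X₁ X₂ : M.obj i} (f : X₁ ⟶ X₂) :
    tensProjHom M S T hT ((PureTensor.left k (M.obj i) Y).map f) =
      ((tensProj M S T hT).app i).map f := rfl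

lemma tensProjHom_comp {i : C} {X₁ X₂ X₃ : M.obj i}
    (t : (⟨X₁, Y⟩ : PureTensor k (M.obj i) A) ⟶ ⟨X₂, Y⟩)
    (t' : (⟨X₂, Y⟩ : PureTensor k (M.obj i) A) ⟶ ⟨X₃, Y⟩) :
    tensProjHom M S T hT (t ≫ t') = tensProjHom M S T hT t ≫ tensProjHom M S T hT t' := by
  unfold tensProjHom
  rw [tensHom_comp]
  exact ((M.inflation A).subquotProj S T i).map_comp _ _

lemma tensProjHom_sub {i : C} {X₁ X₂ : M.obj i}
    (t t' : (⟨X₁, Y⟩ : PureTensor k (M.obj i) A) ⟶ ⟨X₂, Y⟩) :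
    tensProjHom M S T hT (t - t') = tensProjHom M S T hT t - tensProjHom M S T hT t' := by
  unfold tensProjHom
  rw [tensHom_sub]
  exact ((M.inflation A).subquotProj S T i).map_sub

lemma tensProjHom_surjective {i : C} {X₁ X₂ : M.obj i}
    (g : ((tensProj M S T hT).app i).obj X₁ ⟶ ((tensProj M S T hT).app i).obj X₂) :
    ∃ t : (⟨X₁, Y⟩ : PureTensor k (M.obj i) A) ⟶ ⟨X₂, Y⟩, tensProjHom M S T hT t = g := by
  obtain ⟨f, hf⟩ := ((M.inflation A).subquotProj S T i).map_surjective
    (show ((M.inflation A).subquotProj S T i).obj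
        ((tensFunctor M T (T.addClosure_box M hT) i).obj X₁) ⟶
      ((M.inflation A).subquotProj S T i).obj
        ((tensFunctor M T (T.addClosure_box M hT) i).obj X₂) from g)
  obtain ⟨t, rfl⟩ := tensHom_surjective M T (T.addClosure_box M hT) f
  exact ⟨t, hf⟩

lemma map_tensProjHom {i j : C} (F : i ⟶ j) {X₁ X₂ : M.obj i}
    (t : (⟨X₁, Y⟩ : PureTensor k (M.obj i) A) ⟶ ⟨X₂, Y⟩) :
    (((M.inflation A).subquot S T).map F).map (tensProjHom M S T hT t) =
      tensProjHom M S T hT (X₁ := (M.map F).obj X₁) (X₂ := (M.map F).obj X₂)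
        ((PureTensor.map (M.map F)).map t) := rfl

variable [IsAlgClosed k] (hS : ∀ (i : C) (X : M.obj i), IsIndec X → ¬ S.mem i (box k X Y))

include hS in
lemma isLocalObj_tensProj {i : C} {X : M.obj i} (hX : IsIndec X) :
    IsLocalObj (((tensProj M S T hT).app i).obj X) :=
  (M.inflation A).isLocalObj_subquotProj
    (Z := (tensFunctor M T (T.addClosure_box M hT) i).obj X) (hT i X hX) (hS i X hX)

include hS in
lemma isIso_tensProjHom_iff {i : C} {X : M.obj i} (hX : IsIndec X)
    (t : (⟨X, Y⟩ : PureTensor k (M.obj i) A) ⟶ ⟨X, Y⟩) :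
    IsIso (tensProjHom M S T hT t) ↔ IsIso t := by
  rw [← isIso_tensHom_iff M T (T.addClosure_box M hT)]
  have hl : IsLocalObj ((tensFunctor M T (T.addClosure_box M hT) i).obj X) :=
    (M.inflation A).isLocalObj_subrep (T := T) (hT i X hX)
  refine ⟨fun h => ?_, fun h => ?_⟩
  · have h' : IsIso (((M.inflation A).subquotProj S T i).map
      (tensHom M T (T.addClosure_box M hT) t)) := h
    exact hl.isIso_of_map ((M.inflation A).subquotProj S T i)
      (isLocalObj_tensProj M S T hT hS hX).1 _
  · exact Functor.map_isIso ((M.inflation A).subquotProj S T i)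
      (tensHom M T (T.addClosure_box M hT) t)

include hS in
/-- Evaluation at the residue map of `Y` identifies the largest proper ideals: both consist of the
morphisms that do not occur as factors of automorphisms of test objects, namely the indecomposable
objects `X` and the corresponding objects `X ⊠ Y`, and evaluation preserves and reflects
automorphisms. -/
lemma tensProjHom_mem_maxIdeal_iff (hess : ∀ i, ((tensProj M S T hT).app i).EssSurj)
    {χ : End Y →ₐ[k] k} (hχ : ∃ m, RingHom.ker χ ^ m = ⊥) {i : C} {X₁ X₂ : M.obj i}
    (t : (⟨X₁, Y⟩ : PureTensor k (M.obj i) A) ⟶ ⟨X₂, Y⟩) :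
    tensProjHom M S T hT t ∈ ((M.inflation A).subquot S T).maxIdeal.hom _ _ ↔
      PureTensor.eval (PureTensor.resFun χ) t ∈ M.maxIdeal.hom X₁ X₂ := by
  let Θ := tensProj M S T hT
  let L : ∀ i : C, ObjectProperty (M.obj i) := fun _ X => IsIndec X
  have hL : ∀ i X, L i X → IsLocalObj X := fun _ _ hX => isLocalObj_of_isIndec M hX
  have hret : ∀ (i : C) (X : M.obj i), ¬ IsZero X → ∃ Z, L i Z ∧ Nonempty (Retract Z X) :=
    fun i X h0 => by
      obtain ⟨W, hW, -, r⟩ := (sumOf_isIndec_obj M X).exists_retract h0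
      exact ⟨W, hW, r⟩
  let L' : ∀ i : C, ObjectProperty (((M.inflation A).subquot S T).obj i) :=
    fun i Z => ∃ X : M.obj i, IsIndec X ∧ Z = (Θ.app i).obj X
  have hL' : ∀ i Z, L' i Z → IsLocalObj Z := by
    rintro i _ ⟨X, hX, rfl⟩
    exact isLocalObj_tensProj M S T hT hS hX
  have hret' : ∀ (i : C) (Z : ((M.inflation A).subquot S T).obj i), ¬ IsZero Z →
      ∃ W, L' i W ∧ Nonempty (Retract W Z) := fun i Z h0 => by
    have := hess i
    let e := (Θ.app i).objObjPreimageIso Z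
    obtain ⟨W, hW, ⟨r⟩⟩ := hret i ((Θ.app i).objPreimage Z) fun h =>
      h0 (((Θ.app i).map_isZero h).of_iso e.symm)
    exact ⟨_, ⟨W, hW, rfl⟩, ⟨(r.map (Θ.app i)).trans (Retract.ofIso e)⟩⟩
  rw [mem_maxIdeal_iff (hL := hL) hret, mem_maxIdeal_iff (hL := hL') hret']
  -- The composites that have to be invertible correspond to each other under evaluation.
  have key : ∀ (j : C) (F : i ⟶ j) (X : M.obj j), IsIndec X →
      ∀ (a : (⟨X, Y⟩ : PureTensor k (M.obj j) A) ⟶ ⟨(M.map F).obj X₁, Y⟩)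
        (b : (⟨(M.map F).obj X₂, Y⟩ : PureTensor k (M.obj j) A) ⟶ ⟨X, Y⟩),
      IsIso (tensProjHom M S T hT a ≫
        (((M.inflation A).subquot S T).map F).map (tensProjHom M S T hT t) ≫
          tensProjHom M S T hT b) ↔
      IsIso (PureTensor.eval (PureTensor.resFun χ) a ≫
        (M.map F).map (PureTensor.eval (PureTensor.resFun χ) t) ≫
          PureTensor.eval (PureTensor.resFun χ) b) := by
    intro j F X hX a b
    let Ft : (⟨(M.map F).obj X₁, Y⟩ : PureTensor k (M.obj j) A) ⟶ ⟨(M.map F).obj X₂, Y⟩ :=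
      (PureTensor.map (M.map F)).map t
    have h1 : tensProjHom M S T hT a ≫
        (((M.inflation A).subquot S T).map F).map (tensProjHom M S T hT t) ≫
          tensProjHom M S T hT b = tensProjHom M S T hT (a ≫ Ft ≫ b) := by
      rw [map_tensProjHom, tensProjHom_comp, tensProjHom_comp]
      rfl
    have h2 : PureTensor.eval (PureTensor.resFun χ) a ≫
        (M.map F).map (PureTensor.eval (PureTensor.resFun χ) t) ≫
          PureTensor.eval (PureTensor.resFun χ) b =
        PureTensor.eval (PureTensor.resFun χ) (a ≫ Ft ≫ b) := by
      rw [PureTensor.eval_resFun_comp, PureTensor.eval_resFun_comp,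
        ← PureTensor.eval_map (M.map F) (PureTensor.resFun χ) t]
    rw [h1, h2, isIso_tensProjHom_iff M S T hT hS hX]
    exact ⟨fun _ => PureTensor.isIso_eval χ _, PureTensor.isIso_of_isIso_eval hχ _⟩
  constructor
  · intro ht j F X hX g h hiso
    refine ht j F _ ⟨X, hX, rfl⟩ _ _ ((key j F X hX ((PureTensor.left k (M.obj j) Y).map g)
      ((PureTensor.left k (M.obj j) Y).map h)).2 ?_)
    rwa [PureTensor.eval_left_map, PureTensor.eval_left_map]
  · rintro ht j F _ ⟨X, hX, rfl⟩ g h hiso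
    obtain ⟨a, rfl⟩ := tensProjHom_surjective M S T hT (X₂ := (M.map F).obj X₁) g
    obtain ⟨b, rfl⟩ := tensProjHom_surjective M S T hT (X₁ := (M.map F).obj X₂) h
    exact ht j F X hX _ _ ((key j F X hX a b).1 hiso)

variable {S T}

/-- A subquotient whose nonzero indecomposable objects are the `X ⊠ Y`, for a fixed `Y`, has the
same simple transitive quotient as `M`. -/
lemma equivalent_simpleTransitiveQuotient [IsFinitaryCategory k A] [HasFiniteBiproducts A]
    (hY : IsIndec Y) (hT : ∀ (i : C) (X : M.obj i), IsIndec X → T.mem i (box k X Y))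
    (hS : ∀ (i : C) (X : M.obj i), IsIndec X → ¬ S.mem i (box k X Y))
    (hTS : ∀ (i : C) (X' : M.obj i) (Y' : A), IsIndec X' → IsIndec Y' → T.mem i (box k X' Y') →
      ¬ S.mem i (box k X' Y') → Nonempty (Y' ≅ Y)) :
    Equivalent M.simpleTransitiveQuotient
      ((M.inflation A).subquotient S T).simpleTransitiveQuotient := by
  obtain ⟨χ, -, hχ⟩ := hY.exists_residue k
  have hess := essSurj_tensProj M S T hT hTS
  refine equivalent_quotient (tensProj M S T hT) M.maxIdeal
    ((M.inflation A).subquot S T).maxIdeal hess (fun i X₁ X₂ f => ?_) fun i X₁ X₂ g => ?_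
  · rw [← tensProjHom_left, tensProjHom_mem_maxIdeal_iff M S T hT hS hess hχ,
      PureTensor.eval_left_map]
  · obtain ⟨t, rfl⟩ := tensProjHom_surjective M S T hT g
    refine ⟨PureTensor.eval (PureTensor.resFun χ) t, ?_⟩
    rw [← tensProjHom_left, ← tensProjHom_sub, tensProjHom_mem_maxIdeal_iff M S T hT hS hess hχ,
      LinearMap.map_sub, PureTensor.eval_left_map, sub_self]
    exact zero_mem _

lemma equivalent_simple [IsFinitaryCategory k A] (hMt : M.IsTransitive)
    (Q : (M.inflation A).TransitiveSubquotient) :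
    Equivalent M.simpleTransitiveQuotient Q.simple := by
  have : HasFiniteBiproducts A := IsFinitaryCategory.hasFiniteBiproducts k
  obtain ⟨i, Z, hZT, hZS⟩ := Q.ne
  have := hM.finitary i
  obtain ⟨X, Y, hX, hY, ⟨e⟩⟩ := exists_iso_box_of_isIndec (Q.top.isIndec hZT)
  have hT : Q.top.mem i (box k X Y) := Q.top.of_iso e hZT
  have hS : ¬ Q.bot.mem i (box k X Y) := fun h => hZS (Q.bot.of_iso e.symm h)
  refine equivalent_simpleTransitiveQuotient M hY
    (fun j X' hX' => Q.top.mem_box_of_mem_box M hMt hX hX' hY hT)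
    (fun j X' hX' h => hS (Q.bot.mem_box_of_mem_box M hMt hX' hX hY h))
    fun j X' Y' hX' hY' hT' hS' =>
      nonempty_iso_of_isTransitive M Q.bot Q.top Q.isTransitive hX' hY hY' hT hS hT' hS'

end TwoRep

end TwoRepTheory

end

theorem mainTheorem3 {k : Type w} [Field k] [IsAlgClosed k]
    {C : Type u₁} [Bicategory.{w₁, v₁} C] [Bicategory.Strict C]
    [∀ i j : C, Preadditive (i ⟶ j)] [∀ i j : C, Linear k (i ⟶ j)]
    [TwoRepTheory.IsFinitaryTwoCategory k C]
    (M : TwoRepTheory.TwoRep.{w, u₁, v₁, w₁, u, v} k C) [M.IsFinitary] (hM : M.IsTransitive)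
    (A : Type u') [Category.{v'} A] [Preadditive A] [Linear k A]
    [TwoRepTheory.IsFinitaryCategory k A] :
    ∃ _ : (M.inflation A).IsFinitary,
      (M.inflation A).IsIsotypic ∧
      ∀ Q : (M.inflation A).TransitiveSubquotient,
        TwoRepTheory.TwoRep.Equivalent Q.simple M.simpleTransitiveQuotient := by
  have hA := TwoRepTheory.TwoRep.isFinitary_inflation M (A := A)
  refine ⟨hA, fun Q Q' => ?_, fun Q => ?_⟩
  · exact (TwoRepTheory.TwoRep.equivalent_simple M hM Q).symm.trans
      (TwoRepTheory.TwoRep.equivalent_simple M hM Q')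
  · exact (TwoRepTheory.TwoRep.equivalent_simple M hM Q).symm
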